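/- **Setting.** A quantile function is a nonnegative, nondecreasing, right-continuous, integrable function on $[0,1)$ (possibly unbounded near $1$). Let $V$ (values) and $Q$ (qualities) be quantile functions. For quantile functions $F,G$ write $F\prec_w G$ if $\int_x^1F(t)\,dt\le\int_x^1G(t)\,dt$ for all $x\in[0,1]$, and $F\prec G$ if in addition $\int_0^1F=\int_0^1G$. For quantile functions $W,X$ the expected revenue is $$R(W,X)=\int_{(0,1)}(1-t)\,W(t)\,dX(t)+X(0)W(0)\in[0,\infty].$$ A solution is a pair $(W^*,X^*)$ of quantile functions with $W^*\prec V$, $X^*\prec_w Q$ and $R(W^*,X^*)<\infty$ such that $R(W,X)\le R(W^*,X^*)$ for all quantile functions $W\prec V$, $X\prec_w Q$. **Theorem (Optimality of Pooling).** Every solution $(W^*,X^*)$ consists of pooling intervals only: 1. There are $0\le t_m\le t_h\le 1$ such that $X^*=0$ on $[0,t_m)$ (these quantiles are excluded, so they are pooled at quality $0$); $W^*$ is constant on $[t_h,1)$ (these quantiles are pooled at the highest expected value); and $[t_m,t_h)$ is the union of countably many pairwise disjoint intervals $[a_i,b_i)$, $a_i<b_i$, on each of which both $W^*$ and $X^*$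 are constant. 2. Suppose that $V$ and $Q$ are strictly increasing on $[0,1)$ and that the solution is monotone partitional with common support: there are countably many pairwise disjoint intervals $[a_i,b_i)\subseteq[0,1)$, $a_i<b_i$, a $t_m\in[0,1]$ and a quantile function $\widehat X$ such that $W^*(t)=\frac1{b_i-a_i}\int_{a_i}^{b_i}V$ and $\widehat X(t)=\frac1{b_i-a_i}\int_{a_i}^{b_i}Q$ for $t\in[a_i,b_i)$, while $W^*(t)=V(t)$ and $\widehat X(t)=Q(t)$ for $t\in[0,1)\setminus\bigcup_i[a_i,b_i)$, and $X^*(t)=\widehat X(t)\,\mathbb 1_{\{t\ge t_m\}}$. Then every served quantile lies in a pooling interval: $[t_m,1)\subseteq\bigcup_i[a_i,b_i)$. 3. No interval has full disclosure combined with full separation: if $0\le t_1<t_2\le1$ and $V$ and $Q$ are strictly increasing on $[t_1,t_2)$, then it is not the case that $W^*(t)=V(t)$ and $X^*(t)=Q(t)$ for all $t\in[t_1,t_2)$. -/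

import Mathlib

open Set MeasureTheory
open scoped ENNReal

noncomputable section

/-- A quantile function on `[0, 1)` of a distribution on `[0, ∞)` with finite mean: nonnegative,
nondecreasing, right-continuous and integrable. It may be unbounded near `1` (unbounded support).
Only the values on `[0, 1)` matter. -/
structure QuantileFunction where
  toFun : ℝ → ℝ
  monotoneOn : MonotoneOn toFun (Ico 0 1)
  rightContinuous : ∀ t ∈ Ico (0 : ℝ) 1, ContinuousWithinAt toFun (Ici t) t
  nonneg : ∀ t ∈ Ico (0 : ℝ) 1, 0 ≤ toFun t
  integrableOn : IntegrableOn toFun (Ico 0 1)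

namespace QuantileFunction

instance : CoeFun QuantileFunction fun _ => ℝ → ℝ := ⟨toFun⟩

theorem reparam_mem (s : ℝ) : max s 0 / (1 + max s 0) ∈ Ico (0 : ℝ) 1 := by
  have h : 0 ≤ max s 0 := le_max_right _ _
  refine ⟨by positivity, ?_⟩
  rw [div_lt_one (by linarith)]
  linarith

theorem reparam_mono : Monotone fun s : ℝ => max s 0 / (1 + max s 0) := by
  intro s u hsu
  have h1 : 0 ≤ max s 0 := le_max_right _ _
  have h2 : max s 0 ≤ max u 0 := max_le_max hsu le_rfl
  simp only
  rw [div_le_div_iff₀ (by linarith) (by linarith)]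
  nlinarith

theorem reparam_continuous : Continuous fun s : ℝ => max s 0 / (1 + max s 0) := by
  refine Continuous.div (by fun_prop) (by fun_prop) fun s => ?_
  have h : 0 ≤ max s 0 := le_max_right _ _
  linarith

/-- The quantile function in the parameter `s = t / (1 - t) ∈ [0, ∞)`, extended by the constant
`X 0` to `s < 0`; a Stieltjes function on the whole line. -/
def stieltjes (X : QuantileFunction) : StieltjesFunction ℝ where
  toFun s := X (max s 0 / (1 + max s 0))
  mono' _ _ h := X.monotoneOn (reparam_mem _) (reparam_mem _) (reparam_mono h)
  right_continuous' s :=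
    ContinuousWithinAt.comp (t := Ici (max s 0 / (1 + max s 0)))
      (X.rightContinuous _ (reparam_mem s)) reparam_continuous.continuousWithinAt
      fun _ hu => reparam_mono hu

/-- The Lebesgue–Stieltjes measure `dX` on `(0, 1)`: the Stieltjes measure in the parameter
`s = t / (1 - t)`, transported back by `t = s / (1 + s)`. It gives mass `X b - X a` to `(a, b]`
for `0 ≤ a ≤ b < 1`, and no mass outside `(0, 1)`; see `increment_Ioc` and `increment_compl`. -/
def increment (X : QuantileFunction) : Measure ℝ :=
  X.stieltjes.measure.map fun s => max s 0 / (1 + max s 0)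

theorem reparam_preimage_Ioc {a b : ℝ} (ha : 0 ≤ a) (hb : b < 1) (hab : a ≤ b) :
    (fun s : ℝ => max s 0 / (1 + max s 0)) ⁻¹' Ioc a b = Ioc (a / (1 - a)) (b / (1 - b)) := by
  ext s
  have h : 0 ≤ max s 0 := le_max_right _ _
  have h1 : (0 : ℝ) < 1 - a := by linarith
  have h2 : (0 : ℝ) < 1 - b := by linarith
  have h3 : 0 ≤ a / (1 - a) := by positivity
  have h4 : 0 ≤ b / (1 - b) := div_nonneg (ha.trans hab) h2.le
  simp only [mem_preimage, mem_Ioc]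
  rw [lt_div_iff₀ (by linarith), div_le_iff₀ (by linarith)]
  have e1 : a * (1 + max s 0) < max s 0 ↔ a / (1 - a) < max s 0 := by
    rw [div_lt_iff₀ h1]; constructor <;> intro h <;> linarith
  have e2 : max s 0 ≤ b * (1 + max s 0) ↔ max s 0 ≤ b / (1 - b) := by
    rw [le_div_iff₀ h2]; constructor <;> intro h <;> linarith
  rw [e1, e2, lt_max_iff, max_le_iff]
  constructor
  · rintro ⟨h | h, h'⟩
    · exact ⟨h, h'.1⟩
    · linarith
  · rintro ⟨h, h'⟩
    exact ⟨Or.inl h, h', h4⟩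

theorem stieltjes_apply (X : QuantileFunction) {a : ℝ} (ha : 0 ≤ a) (ha' : a < 1) :
    X.stieltjes (a / (1 - a)) = X a := by
  have h1 : (0 : ℝ) < 1 - a := by linarith
  have h3 : 0 ≤ a / (1 - a) := by positivity
  change X.toFun _ = X.toFun a
  congr 1
  rw [max_eq_left h3]
  field_simp
  ring

theorem increment_Ioc (X : QuantileFunction) {a b : ℝ} (ha : 0 ≤ a) (hab : a ≤ b) (hb : b < 1) :
    X.increment (Ioc a b) = ENNReal.ofReal (X b - X a) := by
  rw [increment, Measure.map_apply reparam_continuous.measurable measurableSet_Ioc,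
    reparam_preimage_Ioc ha hb hab, StieltjesFunction.measure_Ioc,
    X.stieltjes_apply ha (hab.trans_lt hb), X.stieltjes_apply (ha.trans hab) hb]

theorem increment_compl (X : QuantileFunction) : X.increment (Ioo 0 1)ᶜ = 0 := by
  rw [increment, Measure.map_apply reparam_continuous.measurable measurableSet_Ioo.compl]
  have hs : (fun s : ℝ => max s 0 / (1 + max s 0)) ⁻¹' (Ioo 0 1)ᶜ = Iic 0 := by
    ext s
    have hm := reparam_mem s
    have h : 0 ≤ max s 0 := le_max_right _ _
    simp only [mem_preimage, mem_compl_iff, mem_Iic]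
    constructor
    · intro hn
      by_contra! hc
      refine hn ⟨?_, hm.2⟩
      have : 0 < max s 0 := lt_max_of_lt_left hc
      positivity
    · intro hle hn
      rw [max_eq_right hle] at hn
      simp at hn
  have hlim : Filter.Tendsto X.stieltjes Filter.atBot (nhds (X 0)) := by
    refine tendsto_const_nhds.congr' ?_
    filter_upwards [Filter.eventually_le_atBot (0 : ℝ)] with s hle
    change X.toFun 0 = X.toFun _
    rw [max_eq_right hle]
    simp
  have h0 : X.stieltjes 0 = X 0 := by
    change X.toFun _ = X.toFun 0
    simp
  rw [hs, StieltjesFunction.measure_Iic _ hlim, h0]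
  simp

end QuantileFunction

/-- Weak majorization `X ≺_w Q`. -/
def WeakMajorizedBy (X Q : QuantileFunction) : Prop :=
  ∀ x ∈ Icc (0 : ℝ) 1, ∫ t in x..1, X t ≤ ∫ t in x..1, Q t

/-- Majorization `W ≺ V`. -/
def MajorizedBy (W V : QuantileFunction) : Prop :=
  WeakMajorizedBy W V ∧ ∫ t in (0 : ℝ)..1, W t = ∫ t in (0 : ℝ)..1, V t

/-- Expected revenue `R(W, X) = ∫₀¹ (1 - t) W(t) dX(t) + X(0) W(0)`, with values in `[0, ∞]`. -/
def revenue (W X : QuantileFunction) : ℝ≥0∞ :=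
  (∫⁻ t, ENNReal.ofReal ((1 - t) * W t) ∂X.increment) + ENNReal.ofReal (X 0 * W 0)

/-- `(W, X)` solves `max R(W, X)` subject to `W ≺ V` and `X ≺_w Q`, the maximum being finite. -/
structure IsSolution (V Q W X : QuantileFunction) : Prop where
  feasible_values : MajorizedBy W V
  feasible_qualities : WeakMajorizedBy X Q
  finite : revenue W X ≠ ∞
  optimal : ∀ W' X' : QuantileFunction, MajorizedBy W' V → WeakMajorizedBy X' Q →
    revenue W' X' ≤ revenue W X

/-- A countable family of pairwise disjoint nonempty intervals `[a, b) ⊆ [0, 1)`, each recorded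
as the pair `(a, b)`. -/
structure IsIntervalFamily (I : Set (ℝ × ℝ)) : Prop where
  countable : I.Countable
  bounds : ∀ J ∈ I, 0 ≤ J.1 ∧ J.1 < J.2 ∧ J.2 ≤ 1
  disjoint : I.PairwiseDisjoint fun J => Ico J.1 J.2

/-- The set of quantiles that lie in some interval of the family. -/
def coveredSet (I : Set (ℝ × ℝ)) : Set ℝ := ⋃ J ∈ I, Ico J.1 J.2

/-- All quantiles in `s` receive the same expected value (or quality). -/
def PooledOn (F : QuantileFunction) (s : Set ℝ) : Prop := ∃ c : ℝ, ∀ t ∈ s, F t = c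

/-- `F` is the monotone partitional quantile function obtained from `G` by averaging over each
interval of the family `I`: it is the mean of `G` on each interval, and `G` elsewhere. -/
def IsMonotonePartitional (F G : QuantileFunction) (I : Set (ℝ × ℝ)) : Prop :=
  (∀ J ∈ I, ∀ t ∈ Ico J.1 J.2, F t = (∫ s in J.1..J.2, G s) / (J.2 - J.1)) ∧
  ∀ t ∈ Ico (0 : ℝ) 1, t ∉ coveredSet I → F t = G t

/-- `F` is weakly monotone partitional: a monotone partitional function for `G` with family `I`,
set to zero at the quantiles below `tm`. -/
def IsWeakMonotonePartitional (F G : QuantileFunction) (I : Set (ℝ × ℝ)) (tm : ℝ) : Prop :=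
  ∃ H : QuantileFunction, IsMonotonePartitional H G I ∧
    ∀ t ∈ Ico (0 : ℝ) 1, F t = if tm ≤ t then H t else 0

end

/-!
Write `μ` for the Stieltjes measure of `X` on `[0, 1)`, with an atom of mass `X 0` at `0`, so that
the revenue is `∫ (1 - t) W dμ`. Replacing `W`, `X` or both on `[a, b)` by their means over `[a, b)`
is always admissible, and every optimality condition that is used says that such a pooling does not
pay. Pooling `X` moves the mass of `μ` on `(a, b)` to the endpoints `a` and `b` and preserves its
barycentre (`QuantileFunction.measure_pool`).

*First-order conditions.* Pooling one of the two functions alone compares a function with its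
chords: at points of increase of `X` the function `(1 - t) W(t)` lies above all its chords
(`IsSolution.qualities_const_of_lt_chord`), and at points of increase of `W` the function
`∫_{[0, t)} (1 - s) dμ(s)` lies below all its chords (`IsSolution.values_const_of_chord_lt`).
Consequently, among the served quantiles below the top pool, `W` and `X` are constant on the same
intervals.

*Second-order condition.* Let `t₀` be served and below the top pool, and suppose that `W` and `X`
are not both constant to the right of `t₀`. Two cases are excluded.

* Both functions are strictly increasing on an interval to the right of `t₀`
  (`IsSolution.not_strictMono`). By the first-order conditions `W` is nearly linear to the right of
  a point `c`, on small scales, so that pooling `X` alone costs little; and `X` grows there at a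
  rate that is bounded above and below, up to a factor of `2`. Pooling `W` as well raises the value
  at `c`, where a fixed fraction of the mass then lies, and this gain exceeds the cost.
* Pooling intervals accumulate at `t₀`. At the endpoints of a pooling interval `[p, q)`, the
  quality jumps at `p` and the value jumps at `q`. Extending `[p, q)` slightly to the right shows
  that the jump of the quality at `q` is at least that at `p`; so `[p, q)` is followed by a pooling
  interval `[q, q')`. Extending that one to the left shows that the jumps of the value, weighted by
  `1 - t`, decrease from `q` to `q'` (`IsSolution.exists_next`). As the quality jumps are bounded
  below, finitely many such steps lead to any pooling interval further to the right
  (`IsSolution.jump_le_jump`). So the value jumps near `t₀` are bounded below, against the right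
  continuity of `W` at `t₀`.

Hence `t₀` begins an interval on which both functions are constant
(`IsSolution.exists_const_right`), and each part of the theorem follows from this.
-/

noncomputable section

namespace QuantileFunction

/-! ### Averages and pooling -/

theorem intervalIntegrable (F : QuantileFunction) {a b : ℝ} (ha : 0 ≤ a) (hab : a ≤ b)
    (hb : b ≤ 1) : IntervalIntegrable F volume a b := by
  rw [intervalIntegrable_iff_integrableOn_Ico_of_le hab]
  exact F.integrableOn.mono_set (Ico_subset_Ico ha hb)

theorem mul_le_integral (F : QuantileFunction) {a b c : ℝ} (ha : 0 ≤ a) (hab : a ≤ b) (hb : b ≤ 1)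
    (h : ∀ t ∈ Ioo a b, c ≤ F t) : (b - a) * c ≤ ∫ t in a..b, F t := by
  have := intervalIntegral.integral_mono_on_of_le_Ioo hab (f := fun _ => c) (g := F)
    intervalIntegrable_const (F.intervalIntegrable ha hab hb) h
  simpa using this

theorem integral_le_mul (F : QuantileFunction) {a b c : ℝ} (ha : 0 ≤ a) (hab : a ≤ b) (hb : b ≤ 1)
    (h : ∀ t ∈ Ioo a b, F t ≤ c) : ∫ t in a..b, F t ≤ (b - a) * c := by
  have := intervalIntegral.integral_mono_on_of_le_Ioo hab (f := F) (g := fun _ => c)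
    (F.intervalIntegrable ha hab hb) intervalIntegrable_const h
  simpa using this

theorem integral_add_adjacent (F : QuantileFunction) {a b c : ℝ} (ha : 0 ≤ a) (hab : a ≤ b)
    (hbc : b ≤ c) (hc : c ≤ 1) : (∫ t in a..b, F t) + ∫ t in b..c, F t = ∫ t in a..c, F t :=
  intervalIntegral.integral_add_adjacent_intervals (F.intervalIntegrable ha hab (hbc.trans hc))
    (F.intervalIntegrable (ha.trans hab) hbc hc)

theorem mono (F : QuantileFunction) {s t : ℝ} (hs : 0 ≤ s) (hst : s ≤ t) (ht : t < 1) :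
    F s ≤ F t :=
  F.monotoneOn ⟨hs, hst.trans_lt ht⟩ ⟨hs.trans hst, ht⟩ hst

/-- The mean of `F` over `[a, b)`. -/
def avg (F : QuantileFunction) (a b : ℝ) : ℝ := (∫ t in a..b, F t) / (b - a)

theorem avg_mul (F : QuantileFunction) {a b : ℝ} (hab : a < b) :
    (b - a) * F.avg a b = ∫ t in a..b, F t := by
  have : b - a ≠ 0 := by linarith
  rw [avg]
  field_simp

theorem le_avg (F : QuantileFunction) {a b : ℝ} (ha : 0 ≤ a) (hab : a < b) (hb : b ≤ 1) :
    F a ≤ F.avg a b := by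
  rw [avg, le_div_iff₀ (by linarith), mul_comm]
  exact F.mul_le_integral ha hab.le hb fun t ht => F.mono ha ht.1.le (ht.2.trans_le hb)

theorem avg_le (F : QuantileFunction) {a b : ℝ} (ha : 0 ≤ a) (hab : a < b) (hb : b < 1) :
    F.avg a b ≤ F b := by
  rw [avg, div_le_iff₀ (by linarith), mul_comm]
  exact F.integral_le_mul ha hab.le hb.le fun t ht => F.mono (ha.trans ht.1.le) ht.2.le hb

/-- Splitting `[a, b)` at `m` and bounding `F` below by its left endpoint values. -/
theorem le_avg_of_mem (F : QuantileFunction) {a m b : ℝ} (ha : 0 ≤ a) (ham : a ≤ m) (hmb : m < b)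
    (hb : b ≤ 1) : (b - m) * (F m - F a) ≤ (b - a) * (F.avg a b - F a) := by
  have h1 := F.mul_le_integral ha ham (hmb.le.trans hb) (c := F a)
    fun t ht => F.mono ha ht.1.le (by linarith [ht.2])
  have h2 := F.mul_le_integral (ha.trans ham) hmb.le hb (c := F m)
    fun t ht => F.mono (ha.trans ham) ht.1.le (by linarith [ht.2])
  have h3 := F.integral_add_adjacent ha ham hmb.le hb
  have h4 := F.avg_mul (ham.trans_lt hmb)
  nlinarith

/-- If `F` is constant on `[a, m)`, only the part `[m, b)` raises the mean over `[a, b)` above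
`F a`. -/
theorem avg_le_of_const (F : QuantileFunction) {a m b : ℝ} (ha : 0 ≤ a) (ham : a ≤ m)
    (hmb : m < b) (hb : b < 1) (hc : ∀ t ∈ Ico a m, F t = F a) :
    (b - a) * (F.avg a b - F a) ≤ (b - m) * (F b - F a) := by
  have h1 := F.integral_le_mul ha ham (hmb.le.trans hb.le) (c := F a)
    fun t ht => (hc t (Ioo_subset_Ico_self ht)).le
  have h2 := F.integral_le_mul (ha.trans ham) hmb.le hb.le (c := F b)
    fun t ht => F.mono (ha.trans (ham.trans ht.1.le)) ht.2.le hb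
  have h3 := F.integral_add_adjacent ha ham hmb.le hb.le
  have h4 := F.avg_mul (ham.trans_lt hmb)
  nlinarith

/-- `F` with the quantiles in `[a, b)` pooled at their mean. -/
def pool (F : QuantileFunction) (a b : ℝ) (ha : 0 ≤ a) (hab : a < b) (hb : b < 1) :
    QuantileFunction where
  toFun t := if t < a then F t else if t < b then F.avg a b else F t
  monotoneOn := by
    intro s hs t ht hst
    have h1 := F.le_avg ha hab hb.le
    have h2 := F.avg_le ha hab hb
    have h0 := F.monotoneOn hs ht hst
    simp only
    split_ifs with c1 c2 c3 c4 c5 c6 c7 <;> first | linarith | skip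
    · exact (F.mono hs.1 c1.le (hab.trans hb)).trans h1
    · exact h2.trans (F.mono (ha.trans hab.le) (not_lt.1 c6) ht.2)
  rightContinuous := by
    intro t ht
    have hF := F.rightContinuous t ht
    rcases lt_or_ge t a with c1 | c1
    · refine hF.congr_of_eventuallyEq ?_ (if_pos c1)
      filter_upwards [nhdsWithin_le_nhds (Iio_mem_nhds c1)] with s hs using if_pos hs
    rcases lt_or_ge t b with c2 | c2
    · refine (continuousWithinAt_const (b := F.avg a b)).congr_of_eventuallyEq ?_ ?_
      · filter_upwards [nhdsWithin_le_nhds (Iio_mem_nhds c2), self_mem_nhdsWithin] with s hs hs'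
        rw [if_neg (not_lt.2 (c1.trans hs')), if_pos (mem_Iio.1 hs)]
      · simp [not_lt.2 c1, c2]
    · refine hF.congr (fun s hs => ?_) ?_
      · rw [if_neg (not_lt.2 (c1.trans hs)), if_neg (not_lt.2 (c2.trans hs))]
      · rw [if_neg (not_lt.2 c1), if_neg (not_lt.2 c2)]
  nonneg := by
    intro t ht
    have h1 := F.le_avg ha hab hb.le
    have h2 := F.nonneg a ⟨ha, hab.trans hb⟩
    have h3 := F.nonneg t ht
    split_ifs <;> linarith
  integrableOn := by
    have h := Integrable.piecewise (s := Ico a b) (μ := volume.restrict (Ico (0 : ℝ) 1))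
      measurableSet_Ico (integrable_const (F.avg a b)).integrableOn
      (F.integrableOn.integrable.integrableOn (s := (Ico a b)ᶜ))
    refine Integrable.congr h (Filter.Eventually.of_forall fun t => ?_)
    by_cases c1 : t < a
    · simp [Set.piecewise, c1, not_le.2 c1]
    · by_cases c2 : t < b <;> simp [Set.piecewise, c1, c2, not_lt.1 c1]

section pool
variable (F : QuantileFunction) {a b : ℝ} (ha : 0 ≤ a) (hab : a < b) (hb : b < 1)

theorem pool_of_mem {t : ℝ} (ht : t ∈ Ico a b) : F.pool a b ha hab hb t = F.avg a b := by
  change ite _ _ _ = _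
  rw [if_neg (not_lt.2 ht.1), if_pos ht.2]

theorem pool_of_lt {t : ℝ} (ht : t < a) : F.pool a b ha hab hb t = F t := if_pos ht

theorem pool_of_ge {t : ℝ} (ht : b ≤ t) : F.pool a b ha hab hb t = F t := by
  change ite _ _ _ = _
  rw [if_neg (not_lt.2 (hab.le.trans ht)), if_neg (not_lt.2 ht)]

theorem pool_of_notMem {t : ℝ} (ht : t ∉ Ico a b) : F.pool a b ha hab hb t = F t := by
  rcases lt_or_ge t a with h | h
  · exact F.pool_of_lt ha hab hb h
  · exact F.pool_of_ge ha hab hb (not_lt.1 fun h' => ht ⟨h, h'⟩)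

theorem integral_pool_of_ge {x y : ℝ} (hx : b ≤ x) (hxy : x ≤ y) :
    ∫ t in x..y, F.pool a b ha hab hb t = ∫ t in x..y, F t := by
  refine intervalIntegral.integral_congr fun t ht => ?_
  rw [uIcc_of_le hxy] at ht
  exact F.pool_of_ge ha hab hb (hx.trans ht.1)

theorem integral_pool_of_le {x y : ℝ} (hy : y ≤ a) (hxy : x ≤ y) :
    ∫ t in x..y, F.pool a b ha hab hb t = ∫ t in x..y, F t := by
  rw [intervalIntegral.integral_of_le hxy, intervalIntegral.integral_of_le hxy,
    integral_Ioc_eq_integral_Ioo, integral_Ioc_eq_integral_Ioo]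
  exact setIntegral_congr_fun measurableSet_Ioo fun t ht =>
    F.pool_of_lt ha hab hb (ht.2.trans_le hy)

theorem integral_pool_of_mem {x : ℝ} (hx : x ∈ Icc a b) :
    ∫ t in x..b, F.pool a b ha hab hb t = (b - x) * F.avg a b := by
  have : ∫ t in x..b, F.pool a b ha hab hb t = ∫ _t in x..b, F.avg a b := by
    rw [intervalIntegral.integral_of_le hx.2, intervalIntegral.integral_of_le hx.2,
      integral_Ioc_eq_integral_Ioo, integral_Ioc_eq_integral_Ioo]
    exact setIntegral_congr_fun measurableSet_Ioo fun t ht =>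
      F.pool_of_mem ha hab hb ⟨hx.1.trans ht.1.le, ht.2⟩
  rw [this]
  simp

theorem integral_pool_eq {x : ℝ} (hx0 : 0 ≤ x) (hx : x ≤ a) :
    ∫ t in x..1, F.pool a b ha hab hb t = ∫ t in x..1, F t := by
  have e1 := (F.pool a b ha hab hb).integral_add_adjacent hx0 hx (hab.le.trans hb.le) le_rfl
  have e2 := (F.pool a b ha hab hb).integral_add_adjacent ha hab.le hb.le le_rfl
  have e3 := F.integral_add_adjacent hx0 hx (hab.le.trans hb.le) le_rfl
  have e4 := F.integral_add_adjacent ha hab.le hb.le le_rfl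
  rw [F.integral_pool_of_le ha hab hb le_rfl hx] at e1
  rw [F.integral_pool_of_mem ha hab hb ⟨le_rfl, hab.le⟩, F.avg_mul hab,
    F.integral_pool_of_ge ha hab hb le_rfl hb.le] at e2
  linarith

theorem pool_majorizedBy : MajorizedBy (F.pool a b ha hab hb) F := by
  refine ⟨fun x hx => ?_, F.integral_pool_eq ha hab hb le_rfl ha⟩
  rcases le_total x a with h | h
  · exact (F.integral_pool_eq ha hab hb hx.1 h).le
  rcases le_total b x with h' | h'
  · exact (F.integral_pool_of_ge ha hab hb h' hx.2).le
  have e2 := (F.pool a b ha hab hb).integral_add_adjacent hx.1 h' hb.le le_rfl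
  have e4 := F.integral_add_adjacent hx.1 h' hb.le le_rfl
  rw [F.integral_pool_of_mem ha hab hb ⟨h, h'⟩,
    F.integral_pool_of_ge ha hab hb le_rfl hb.le] at e2
  have e5 := F.integral_add_adjacent ha h h' hb.le
  have e6 := F.integral_le_mul ha h hx.2 (c := F x)
    fun t ht => F.mono (ha.trans ht.1.le) ht.2.le (h'.trans_lt hb)
  have e7 := F.mul_le_integral hx.1 h' hb.le (c := F x)
    fun t ht => F.mono hx.1 ht.1.le (ht.2.trans hb)
  have e8 := F.avg_mul hab
  have e9 : (b - x) * F.avg a b ≤ ∫ t in x..b, F t := by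
    have : 0 < b - a := by linarith
    refine le_of_mul_le_mul_left ?_ this
    have h1 : (b - x) * (∫ t in a..x, F t) ≤ (b - x) * ((x - a) * F x) :=
      mul_le_mul_of_nonneg_left e6 (by linarith)
    have h2 : (x - a) * ((b - x) * F x) ≤ (x - a) * (∫ t in x..b, F t) :=
      mul_le_mul_of_nonneg_left e7 (by linarith)
    have h3 : (b - a) * ((b - x) * F.avg a b) = (b - x) * ∫ t in a..b, F t := by rw [← e8]; ring
    rw [h3, ← e5]
    nlinarith
  linarith

end pool

end QuantileFunction

theorem WeakMajorizedBy.trans {F G H : QuantileFunction} (h : WeakMajorizedBy F G)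
    (h' : WeakMajorizedBy G H) : WeakMajorizedBy F H :=
  fun x hx => (h x hx).trans (h' x hx)

theorem MajorizedBy.trans {F G H : QuantileFunction} (h : MajorizedBy F G)
    (h' : MajorizedBy G H) : MajorizedBy F H :=
  ⟨h.1.trans h'.1, h.2.trans h'.2⟩

theorem MajorizedBy.refl (F : QuantileFunction) : MajorizedBy F F := ⟨fun _ _ => le_rfl, rfl⟩

namespace QuantileFunction

/-! ### The measure of a quantile function -/

/-- The Lebesgue–Stieltjes measure of `X` on `[0, 1)`, where `X` is regarded as `0` to the left
of `0`: it adds to `dX` an atom of mass `X 0` at `0`, so that `X` is its distribution function and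
`revenue W X` is a single integral. -/
def measure (X : QuantileFunction) : Measure ℝ :=
  X.increment + ENNReal.ofReal (X 0) • Measure.dirac 0

theorem measure_Iic (X : QuantileFunction) {t : ℝ} (h0 : 0 ≤ t) (h1 : t < 1) :
    X.measure (Iic t) = ENNReal.ofReal (X t) := by
  have hi : X.increment (Iic t) = ENNReal.ofReal (X t - X 0) := by
    rw [← X.increment_Ioc le_rfl h0 h1]
    refine le_antisymm ?_ (measure_mono Ioc_subset_Iic_self)
    have hsub : Iic t ⊆ Ioc 0 t ∪ (Ioo 0 1)ᶜ := by
      intro s hs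
      by_cases h : 0 < s
      · exact Or.inl ⟨h, hs⟩
      · exact Or.inr fun h' => h h'.1
    refine (measure_mono hsub).trans ((measure_union_le _ _).trans ?_)
    rw [X.increment_compl, add_zero]
  rw [measure, Measure.add_apply, hi, Measure.smul_apply,
    Measure.dirac_apply_of_mem (mem_Iic.2 h0), smul_eq_mul, mul_one,
    ← ENNReal.ofReal_add (sub_nonneg.2 (X.mono le_rfl h0 h1)) (X.nonneg 0 ⟨le_rfl, one_pos⟩)]
  simp

theorem measure_Iio_zero (X : QuantileFunction) : X.measure (Iio 0) = 0 := by
  have : X.increment (Iio 0) = 0 :=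
    measure_mono_null (t := (Ioo 0 1)ᶜ) (fun s hs h => lt_asymm h.1 hs) X.increment_compl
  simp [measure, this]

theorem measure_Ici_one (X : QuantileFunction) : X.measure (Ici 1) = 0 := by
  have : X.increment (Ici 1) = 0 :=
    measure_mono_null (t := (Ioo 0 1)ᶜ) (fun s hs h => not_le.2 h.2 hs) X.increment_compl
  simp [measure, this]

theorem revenue_eq (W X : QuantileFunction) :
    revenue W X = ∫⁻ t, ENNReal.ofReal ((1 - t) * W t) ∂X.measure := by
  rw [measure, lintegral_add_measure, lintegral_smul_measure, lintegral_dirac, revenue,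
    ENNReal.ofReal_mul (X.nonneg 0 ⟨le_rfl, one_pos⟩)]
  simp

/-- `X.measure` is the only measure on `[0, 1)` with distribution function `X`. -/
theorem measure_unique (X : QuantileFunction) (ν : Measure ℝ) (h0 : ν (Iio 0) = 0)
    (h1 : ν (Ici 1) = 0) (h : ∀ t ∈ Ico (0 : ℝ) 1, ν (Iic t) = ENNReal.ofReal (X t)) :
    ν = X.measure := by
  have key : ∀ c < (1 : ℝ), ν.restrict (Iic c) = X.measure.restrict (Iic c) := by
    intro c hc
    have hle : ∀ t < (1 : ℝ), ν (Iic t) = X.measure (Iic t) := by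
      intro t ht
      rcases le_or_gt 0 t with h' | h'
      · rw [h t ⟨h', ht⟩, X.measure_Iic h' ht]
      · rw [measure_mono_null (Iic_subset_Iio.2 h') h0,
          measure_mono_null (Iic_subset_Iio.2 h') X.measure_Iio_zero]
    have hfin : ν (Iic c) < ∞ := by
      rw [hle c hc]
      refine (measure_mono (Iic_subset_Iic.2 (le_max_left c 0))).trans_lt ?_
      rw [X.measure_Iic (le_max_right c 0) (max_lt hc one_pos)]
      exact ENNReal.ofReal_lt_top
    have : IsFiniteMeasure (ν.restrict (Iic c)) := ⟨by simpa using hfin⟩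
    refine Measure.ext_of_Iic _ _ fun t => ?_
    rw [Measure.restrict_apply measurableSet_Iic, Measure.restrict_apply measurableSet_Iic,
      Iic_inter_Iic]
    exact hle _ (min_lt_of_right_lt hc)
  have hU : (⋃ n : ℕ, Iic (1 - 1 / ((n : ℝ) + 1))) = Iio 1 := by
    ext t
    simp only [mem_iUnion, mem_Iic, mem_Iio]
    constructor
    · rintro ⟨n, hn⟩
      have : 0 < 1 / ((n : ℝ) + 1) := by positivity
      linarith
    · intro ht
      obtain ⟨n, hn⟩ := exists_nat_one_div_lt (sub_pos.2 ht)
      exact ⟨n, by linarith⟩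
  have hr : ν.restrict (Iio 1) = X.measure.restrict (Iio 1) := by
    rw [← hU, Measure.restrict_iUnion_congr]
    intro n
    have : 0 < 1 / ((n : ℝ) + 1) := by positivity
    exact key _ (by linarith)
  have hs : ∀ m : Measure ℝ, m (Ici 1) = 0 → m.restrict (Iio 1) = m := by
    intro m hm
    refine Measure.restrict_eq_self_of_ae_mem ?_
    rw [ae_iff]
    simpa [Ici_def] using hm
  rw [← hs ν h1, ← hs X.measure X.measure_Ici_one, hr]

theorem measure_Iic_ne_top (X : QuantileFunction) {t : ℝ} (h1 : t < 1) :
    X.measure (Iic t) ≠ ∞ := by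
  refine ne_top_of_le_ne_top ?_ (measure_mono (Iic_subset_Iic.2 (le_max_left t 0)))
  rw [X.measure_Iic (le_max_right t 0) (max_lt h1 one_pos)]
  exact ENNReal.ofReal_ne_top

theorem measure_ne_top_of_subset (X : QuantileFunction) {s : Set ℝ} {b : ℝ} (hb : b < 1)
    (hs : s ⊆ Iic b) : X.measure s ≠ ∞ :=
  ne_top_of_le_ne_top (X.measure_Iic_ne_top hb) (measure_mono hs)

theorem measure_Icc_ne_top (X : QuantileFunction) {a b : ℝ} (hb : b < 1) :
    X.measure (Icc a b) ≠ ∞ := X.measure_ne_top_of_subset hb Icc_subset_Iic_self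

theorem real_Iic (X : QuantileFunction) {t : ℝ} (h0 : 0 ≤ t) (h1 : t < 1) :
    X.measure.real (Iic t) = X t := by
  rw [Measure.real, X.measure_Iic h0 h1, ENNReal.toReal_ofReal (X.nonneg t ⟨h0, h1⟩)]

theorem real_Ioc (X : QuantileFunction) {a b : ℝ} (ha : 0 ≤ a) (hab : a ≤ b) (hb : b < 1) :
    X.measure.real (Ioc a b) = X b - X a := by
  have h := measureReal_union (μ := X.measure) (s₁ := Iic a) (s₂ := Ioc a b)
    (Set.disjoint_left.2 fun s hs hs' => not_lt.2 hs hs'.1) measurableSet_Ioc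
    (X.measure_Iic_ne_top (hab.trans_lt hb))
    (X.measure_ne_top_of_subset hb Ioc_subset_Iic_self)
  rw [Iic_union_Ioc_eq_Iic hab, X.real_Iic (ha.trans hab) hb, X.real_Iic ha (hab.trans_lt hb)] at h
  linarith

theorem real_Ico_zero (X : QuantileFunction) {t : ℝ} (h0 : 0 ≤ t) (h1 : t < 1) :
    X.measure.real (Ico 0 t) + X.measure.real {t} = X t := by
  have h := measureReal_union (μ := X.measure) (s₁ := Ico 0 t) (s₂ := {t})
    (by simp) (measurableSet_singleton t)
    (X.measure_ne_top_of_subset h1 fun s hs => hs.2.le)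
    (X.measure_ne_top_of_subset h1 (by simp))
  rw [Ico_union_right h0] at h
  rw [← h, ← X.real_Iic h0 h1]
  have h' := measureReal_union (μ := X.measure) (s₁ := Iio 0) (s₂ := Icc 0 t)
    (Set.disjoint_left.2 fun s hs hs' => not_lt.2 hs'.1 hs) measurableSet_Icc
    (by simp [X.measure_Iio_zero]) (X.measure_Icc_ne_top h1)
  have e : Iio 0 ∪ Icc 0 t = Iic t := by
    ext s
    simp only [mem_union, mem_Iio, mem_Icc, mem_Iic]
    constructor
    · rintro (h | h) <;> linarith [h0]
    · intro h
      rcases lt_or_ge s 0 with h' | h'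
      · exact Or.inl h'
      · exact Or.inr ⟨h', h⟩
  rw [← e, h', Measure.real, Measure.real, X.measure_Iio_zero]
  simp

theorem real_Icc (X : QuantileFunction) {a b : ℝ} (ha : 0 ≤ a) (hab : a ≤ b) (hb : b < 1) :
    X.measure.real (Icc a b) = X.measure.real {a} + (X b - X a) := by
  rw [← X.real_Ioc ha hab hb, ← measureReal_union (by simp) measurableSet_Ioc
    (X.measure_ne_top_of_subset hb (by simpa using hab))
    (X.measure_ne_top_of_subset hb Ioc_subset_Iic_self), singleton_union, Ioc_insert_left hab]

theorem real_Ioo (X : QuantileFunction) {a b : ℝ} (ha : 0 ≤ a) (hab : a < b) (hb : b < 1) :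
    X.measure.real (Ioo a b) + X.measure.real {b} = X b - X a := by
  rw [← X.real_Ioc ha hab.le hb, ← measureReal_union (by simp) (measurableSet_singleton b)
    (X.measure_ne_top_of_subset hb fun s hs => hs.2.le)
    (X.measure_ne_top_of_subset hb (by simp)), Ioo_union_right hab]

theorem const_of_measure_Ioo_eq_zero (X : QuantileFunction) {a b : ℝ} (ha : 0 ≤ a) (hb : b ≤ 1)
    (h : X.measure (Ioo a b) = 0) : ∀ t ∈ Ico a b, X t = X a := by
  intro t ht
  have h1 := X.real_Ioc ha ht.1 (ht.2.trans_le hb)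
  rw [Measure.real, measure_mono_null (t := Ioo a b) (fun s hs => ⟨hs.1, hs.2.trans_lt ht.2⟩) h]
    at h1
  simp only [ENNReal.toReal_zero] at h1
  linarith

theorem measure_Ioo_eq_zero_of_const (X : QuantileFunction) {a b : ℝ} (ha : 0 ≤ a) (hb : b < 1)
    (h : ∀ t ∈ Ico a b, X t = X a) : X.measure (Ioo a b) = 0 := by
  have hc : Ioo a b ⊆ ⋃ n : ℕ, Ioc a (b - 1 / ((n : ℝ) + 1)) := by
    intro s hs
    obtain ⟨n, hn⟩ := exists_nat_one_div_lt (sub_pos.2 hs.2)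
    exact mem_iUnion.2 ⟨n, hs.1, by linarith⟩
  refine measure_mono_null hc (measure_iUnion_null fun n => ?_)
  have hp : 0 < 1 / ((n : ℝ) + 1) := by positivity
  rcases le_or_gt a (b - 1 / ((n : ℝ) + 1)) with h' | h'
  · have h1 := X.real_Ioc ha h' (by linarith)
    rw [h _ ⟨h', by linarith⟩, sub_self, measureReal_eq_zero_iff
      (X.measure_ne_top_of_subset (b := b) hb fun s hs => mem_Iic.2 (by linarith [hs.2]))] at h1
    exact h1
  · rw [Ioc_eq_empty (not_lt.2 h'.le)]
    exact measure_empty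

/-! ### Integrability of monotone functions -/

theorem integrableOn_of_measure (F : QuantileFunction) {μ : Measure ℝ} {a b : ℝ} (ha : 0 ≤ a)
    (hab : a ≤ b) (hb : b < 1) (hμ : μ (Icc a b) ≠ ∞) : IntegrableOn F (Icc a b) μ :=
  (F.monotoneOn.mono fun _ hs => ⟨ha.trans hs.1, hs.2.trans_lt hb⟩).integrableOn_of_measure_ne_top
    (isLeast_Icc hab) (isGreatest_Icc hab) hμ measurableSet_Icc

theorem integrableOn_mul (F : QuantileFunction) {μ : Measure ℝ} {a b : ℝ} (ha : 0 ≤ a)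
    (hab : a ≤ b) (hb : b < 1) (hμ : μ (Icc a b) ≠ ∞) :
    IntegrableOn (fun t => (1 - t) * F t) (Icc a b) μ :=
  (F.integrableOn_of_measure ha hab hb hμ).continuousOn_mul (by fun_prop) isCompact_Icc

theorem integrableOn_continuous (X : QuantileFunction) {a b : ℝ} (hb : b < 1)
    {f : ℝ → ℝ} (hf : Continuous f) : IntegrableOn f (Icc a b) X.measure :=
  hf.continuousOn.integrableOn_of_subset_isCompact isCompact_Icc measurableSet_Icc Subset.rfl
    (X.measure_Icc_ne_top hb)

end QuantileFunction

theorem setIntegral_Icc_eq {μ : Measure ℝ} {f : ℝ → ℝ} {a b : ℝ} (hab : a < b)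
    (hf : IntegrableOn f (Icc a b) μ) :
    ∫ t in Icc a b, f t ∂μ = μ.real {a} * f a + (∫ t in Ioo a b, f t ∂μ) + μ.real {b} * f b := by
  have e1 : Icc a b = (({a} : Set ℝ) ∪ Ioo a b) ∪ {b} := by
    rw [singleton_union, Ioo_insert_left hab, Ico_union_right hab.le]
  have i1 : IntegrableOn f {a} μ := hf.mono_set (by simpa using hab.le)
  have i2 : IntegrableOn f (Ioo a b) μ := hf.mono_set Ioo_subset_Icc_self
  have i3 : IntegrableOn f {b} μ := hf.mono_set (by simpa using hab.le)
  rw [e1, setIntegral_union (by simp [hab.ne']) (measurableSet_singleton b) (i1.union i2) i3,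
    setIntegral_union (by simp) measurableSet_Ioo i1 i2, integral_singleton, integral_singleton]
  simp

theorem setIntegral_Ico_eq {μ : Measure ℝ} {f : ℝ → ℝ} {a b : ℝ} (hab : a < b)
    (hf : IntegrableOn f (Icc a b) μ) :
    ∫ t in Ico a b, f t ∂μ = μ.real {a} * f a + ∫ t in Ioo a b, f t ∂μ := by
  have e1 : Ico a b = ({a} : Set ℝ) ∪ Ioo a b := by
    rw [singleton_union, Ioo_insert_left hab]
  have i1 : IntegrableOn f {a} μ := hf.mono_set (by simpa using hab.le)
  have i2 : IntegrableOn f (Ioo a b) μ := hf.mono_set Ioo_subset_Icc_self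
  rw [e1, setIntegral_union (by simp) measurableSet_Ioo i1 i2, integral_singleton]
  simp

namespace QuantileFunction

/-! ### Fubini's theorem and the measure of a pooled quantile function -/

/-- Fubini's theorem for `F t - F a`, the mass that `dF` gives to `(a, t]`. -/
theorem integral_mul_sub (F : QuantileFunction) {μ : Measure ℝ} {f : ℝ → ℝ} {a b : ℝ}
    (ha : 0 ≤ a) (hb : b < 1) (hμ : μ (Ico a b) ≠ ∞)
    (hf : IntegrableOn f (Ico a b) μ) :
    ∫ t in Ico a b, f t * (F t - F a) ∂μ =
      ∫ s in Ioo a b, (∫ t in Ico s b, f t ∂μ) ∂F.measure := by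
  have : IsFiniteMeasure (μ.restrict (Ico a b)) := ⟨by simpa using hμ.lt_top⟩
  have : IsFiniteMeasure (F.measure.restrict (Ioo a b)) :=
    ⟨by simpa using (F.measure_ne_top_of_subset hb fun s hs => hs.2.le).lt_top⟩
  have hint : Integrable (Function.uncurry fun t s => (Iic t).indicator (fun _ => f t) s)
      ((μ.restrict (Ico a b)).prod (F.measure.restrict (Ioo a b))) := by
    have h := (Integrable.comp_fst hf (F.measure.restrict (Ioo a b))).indicator
      (measurableSet_le measurable_snd measurable_fst)
    refine h.congr (Filter.Eventually.of_forall fun p => ?_)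
    simp [Set.indicator, Function.uncurry]
  have hswap := integral_integral_swap hint
  have e1 : ∫ t in Ico a b, f t * (F t - F a) ∂μ = ∫ t in Ico a b,
      (∫ s in Ioo a b, (Iic t).indicator (fun _ => f t) s ∂F.measure) ∂μ := by
    refine setIntegral_congr_fun measurableSet_Ico fun t ht => ?_
    rw [integral_indicator_const _ measurableSet_Iic, measureReal_restrict_apply measurableSet_Iic,
      ← F.real_Ioc ha ht.1 (ht.2.trans hb), smul_eq_mul, mul_comm]
    congr 2
    ext s
    exact ⟨fun h => ⟨h.2, h.1, h.2.trans_lt ht.2⟩, fun h => ⟨h.2.1, h.1⟩⟩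
  have e2 : ∫ s in Ioo a b, (∫ t in Ico s b, f t ∂μ) ∂F.measure = ∫ s in Ioo a b,
      (∫ t in Ico a b, (Iic t).indicator (fun _ => f t) s ∂μ) ∂F.measure := by
    refine setIntegral_congr_fun measurableSet_Ioo fun s hs => ?_
    have : (fun t => (Iic t).indicator (fun _ => f t) s) = (Ici s).indicator f := by
      ext t
      simp [Set.indicator]
    rw [this, integral_indicator measurableSet_Ici, Measure.restrict_restrict measurableSet_Ici]
    congr 2
    ext t
    exact ⟨fun h => ⟨h.1, hs.1.le.trans h.1, h.2⟩, fun h => ⟨h.1, h.2.2⟩⟩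
  rw [e1, e2, hswap]

theorem avg_sub_mul (F : QuantileFunction) {a b : ℝ} (ha : 0 ≤ a) (hab : a < b) (hb : b < 1) :
    (b - a) * (F.avg a b - F a) = ∫ s in Ioo a b, (b - s) ∂F.measure := by
  have h := F.integral_mul_sub (μ := volume) (f := fun _ => 1) ha hb (by simp) (by simp)
  have e1 : ∀ s ∈ Ioo a b, ∫ _t in Ico s b, (1 : ℝ) = b - s := by
    intro s hs
    simp [hs.2.le]
  rw [setIntegral_congr_fun measurableSet_Ioo e1] at h
  rw [← h]
  simp only [one_mul]
  rw [integral_sub ((F.integrableOn.mono_set (Ico_subset_Ico ha hb.le))) (by simp),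
    integral_Ico_eq_integral_Ioo, ← integral_Ioc_eq_integral_Ioo,
    ← intervalIntegral.integral_of_le hab.le, ← F.avg_mul hab]
  simp [hab.le]
  ring

theorem integrableOn_Ioo (F : QuantileFunction) {a b : ℝ} (hb : b < 1)
    {f : ℝ → ℝ} (hf : Continuous f) : IntegrableOn f (Ioo a b) F.measure :=
  (F.integrableOn_continuous hb hf).mono_set Ioo_subset_Icc_self

/-- The mass that pooling on `[a, b)` moves from `(a, b)` to the endpoint `b`. The remaining mass,
`F.avg a b - F a`, moves to `a`. -/
def upperShift (F : QuantileFunction) (a b : ℝ) : ℝ :=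
  F.measure.real (Ioo a b) - (F.avg a b - F a)

theorem upperShift_mul (F : QuantileFunction) {a b : ℝ} (ha : 0 ≤ a) (hab : a < b) (hb : b < 1) :
    (b - a) * F.upperShift a b = ∫ s in Ioo a b, (s - a) ∂F.measure := by
  have h1 : ∫ _s in Ioo a b, (b - a) ∂F.measure = (b - a) * F.measure.real (Ioo a b) := by
    rw [setIntegral_const, smul_eq_mul, mul_comm]
  have h2 : ∫ s in Ioo a b, (s - a) ∂F.measure = ∫ s in Ioo a b, ((b - a) - (b - s)) ∂F.measure :=
    setIntegral_congr_fun measurableSet_Ioo fun s _ => by ring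
  rw [h2, integral_sub (F.integrableOn_Ioo hb (by fun_prop)) (F.integrableOn_Ioo hb (by fun_prop)),
    h1, ← F.avg_sub_mul ha hab hb, upperShift]
  ring

theorem upperShift_nonneg (F : QuantileFunction) {a b : ℝ} (ha : 0 ≤ a) (hab : a < b)
    (hb : b < 1) : 0 ≤ F.upperShift a b := by
  have h := F.upperShift_mul ha hab hb
  have h' : 0 ≤ ∫ s in Ioo a b, (s - a) ∂F.measure :=
    setIntegral_nonneg measurableSet_Ioo fun s hs => by linarith [hs.1]
  rw [← h] at h'
  exact nonneg_of_mul_nonneg_right h' (by linarith)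

/-- An affine function has the same integral before and after the mass on `(a, b)` is moved to the
endpoints. -/
theorem integral_one_sub (F : QuantileFunction) {a b : ℝ} (ha : 0 ≤ a) (hab : a < b)
    (hb : b < 1) : ∫ s in Ioo a b, (1 - s) ∂F.measure =
      (1 - a) * (F.avg a b - F a) + (1 - b) * F.upperShift a b := by
  have h1 := F.avg_sub_mul ha hab hb
  have h2 := F.upperShift_mul ha hab hb
  have hne : b - a ≠ 0 := by linarith
  have h3 : (b - a) * ∫ s in Ioo a b, (1 - s) ∂F.measure =
      (1 - a) * ∫ s in Ioo a b, (b - s) ∂F.measure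
        + (1 - b) * ∫ s in Ioo a b, (s - a) ∂F.measure := by
    rw [← integral_const_mul, ← integral_const_mul, ← integral_const_mul, ← integral_add
      ((F.integrableOn_Ioo hb (by fun_prop))) ((F.integrableOn_Ioo hb (by fun_prop)))]
    exact setIntegral_congr_fun measurableSet_Ioo fun s _ => by ring
  rw [← h1, ← h2] at h3
  apply mul_left_cancel₀ hne
  linarith

section pool
variable (F : QuantileFunction) {a b : ℝ} (ha : 0 ≤ a) (hab : a < b) (hb : b < 1)

/-- Pooling on `[a, b)` moves the mass on `(a, b)` to `a` and `b`, preserving its barycentre. -/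
theorem measure_pool : (F.pool a b ha hab hb).measure = F.measure.restrict (Ioo a b)ᶜ +
    ENNReal.ofReal (F.avg a b - F a) • Measure.dirac a +
    ENNReal.ofReal (F.upperShift a b) • Measure.dirac b := by
  have hA : 0 ≤ F.avg a b - F a := sub_nonneg.2 (F.le_avg ha hab hb.le)
  have hB := F.upperShift_nonneg ha hab hb
  symm
  refine measure_unique _ _ ?_ ?_ fun t ht => ?_
  · have h1 : F.measure.restrict (Ioo a b)ᶜ (Iio 0) = 0 :=
      Measure.absolutelyContinuous_of_le Measure.restrict_le_self F.measure_Iio_zero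
    simp [h1, ha, ha.trans hab.le]
  · have h1 : F.measure.restrict (Ioo a b)ᶜ (Ici 1) = 0 :=
      Measure.absolutelyContinuous_of_le Measure.restrict_le_self F.measure_Ici_one
    simp [h1, hb, hab.trans hb]
  · simp only [Measure.add_apply, Measure.smul_apply, smul_eq_mul,
      Measure.restrict_apply measurableSet_Iic]
    rcases lt_or_ge t a with h1 | h1
    · have e : Iic t ∩ (Ioo a b)ᶜ = Iic t := by
        rw [inter_eq_left]
        intro s hs h'
        exact lt_asymm h'.1 (lt_of_le_of_lt hs h1)
      rw [e, F.pool_of_lt ha hab hb h1, F.measure_Iic ht.1 ht.2]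
      simp [h1, h1.trans hab]
    rcases lt_or_ge t b with h2 | h2
    · have e : Iic t ∩ (Ioo a b)ᶜ = Iic a := by
        ext s
        simp only [mem_inter_iff, mem_Iic, mem_compl_iff, mem_Ioo, not_and, not_lt]
        constructor
        · rintro ⟨h3, h4⟩
          by_contra! h5
          linarith [h4 h5]
        · intro h3
          exact ⟨h3.trans h1, fun h4 => by linarith⟩
      rw [e, F.pool_of_mem ha hab hb ⟨h1, h2⟩, F.measure_Iic ha (hab.trans hb)]
      simp only [Measure.dirac_apply, indicator_of_mem (mem_Iic.2 h1),
        indicator_of_notMem (mt mem_Iic.1 (not_le.2 h2)), Pi.one_apply, mul_one, mul_zero, add_zero]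
      rw [← ENNReal.ofReal_add (F.nonneg a ⟨ha, hab.trans hb⟩) hA]
      congr 1
      ring
    · have h3 := measure_inter_add_sdiff (μ := F.measure) (Iic t) (t := Ioo a b) measurableSet_Ioo
      have e : Iic t ∩ Ioo a b = Ioo a b := by
        rw [inter_eq_right]
        exact fun s hs => (hs.2.le.trans h2)
      rw [e] at h3
      simp only [Measure.dirac_apply, indicator_of_mem (mem_Iic.2 h1),
        indicator_of_mem (mem_Iic.2 h2), Pi.one_apply, mul_one]
      rw [F.pool_of_ge ha hab hb h2, ← F.measure_Iic ht.1 ht.2, ← h3, add_assoc,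
        ← ENNReal.ofReal_add hA hB, upperShift, add_sub_cancel, Measure.real,
        ENNReal.ofReal_toReal (F.measure_ne_top_of_subset hb fun s hs => hs.2.le), add_comm]
      rfl

theorem real_pool_left : (F.pool a b ha hab hb).measure.real {a} =
    F.measure.real {a} + (F.avg a b - F a) := by
  have hA : 0 ≤ F.avg a b - F a := sub_nonneg.2 (F.le_avg ha hab hb.le)
  have e : ({a} : Set ℝ) ∩ (Ioo a b)ᶜ = {a} := by simp
  rw [Measure.real, F.measure_pool ha hab hb]
  simp only [Measure.add_apply, Measure.smul_apply, smul_eq_mul,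
      Measure.restrict_apply (measurableSet_singleton a), e]
  rw [Measure.dirac_apply_of_mem (mem_singleton a),
    Measure.dirac_apply' _ (measurableSet_singleton a), indicator_of_notMem (by simp [hab.ne'])]
  rw [mul_one, mul_zero, add_zero, ENNReal.toReal_add
    (F.measure_ne_top_of_subset (hab.trans hb) (by simp)) (by simp), ENNReal.toReal_ofReal hA]
  rfl

theorem real_pool_right : (F.pool a b ha hab hb).measure.real {b} =
    F.measure.real {b} + F.upperShift a b := by
  have hB := F.upperShift_nonneg ha hab hb
  have e : ({b} : Set ℝ) ∩ (Ioo a b)ᶜ = {b} := by simp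
  rw [Measure.real, F.measure_pool ha hab hb]
  simp only [Measure.add_apply, Measure.smul_apply, smul_eq_mul,
      Measure.restrict_apply (measurableSet_singleton b), e]
  rw [Measure.dirac_apply_of_mem (mem_singleton b),
    Measure.dirac_apply' _ (measurableSet_singleton b), indicator_of_notMem (by simp [hab.ne])]
  rw [mul_one, mul_zero, add_zero, ENNReal.toReal_add
    (F.measure_ne_top_of_subset hb (by simp)) (by simp), ENNReal.toReal_ofReal hB]
  rfl

theorem measure_pool_Ioo : (F.pool a b ha hab hb).measure (Ioo a b) = 0 := by
  rw [F.measure_pool ha hab hb]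
  simp [Measure.restrict_apply measurableSet_Ioo]

theorem measure_pool_restrict_compl : (F.pool a b ha hab hb).measure.restrict (Icc a b)ᶜ =
    F.measure.restrict (Icc a b)ᶜ := by
  rw [F.measure_pool ha hab hb, Measure.restrict_add, Measure.restrict_add, Measure.restrict_smul,
    Measure.restrict_smul, Measure.restrict_restrict measurableSet_Icc.compl,
    inter_eq_left.2 (compl_subset_compl.2 Ioo_subset_Icc_self),
    restrict_dirac' measurableSet_Icc.compl, restrict_dirac' measurableSet_Icc.compl]
  simp [hab.le]

end pool
end QuantileFunction

/-! ### Optimality against pooling -/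

namespace IsSolution
open QuantileFunction

variable {V Q W X : QuantileFunction}

/-- An admissible change of the solution on `[a, b]` alone does not raise the revenue collected
there. The contribution of the other quantiles, possibly unbounded near `1`, is unchanged and
finite, so that it cancels. -/
theorem setIntegral_le (hsol : IsSolution V Q W X) {W' X' : QuantileFunction}
    (hW : MajorizedBy W' W) (hX : WeakMajorizedBy X' X) {a b : ℝ} (ha : 0 ≤ a) (hab : a ≤ b)
    (hb : b < 1) (hWe : ∀ t ∉ Icc a b, W' t = W t)
    (hXe : X'.measure.restrict (Icc a b)ᶜ = X.measure.restrict (Icc a b)ᶜ) :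
    ∫ t in Icc a b, (1 - t) * W' t ∂X'.measure ≤ ∫ t in Icc a b, (1 - t) * W t ∂X.measure := by
  have hopt := hsol.optimal W' X' (hW.trans hsol.feasible_values) (hX.trans hsol.feasible_qualities)
  have hfin := hsol.finite
  rw [revenue_eq, revenue_eq, ← lintegral_add_compl _ (measurableSet_Icc (a := a) (b := b)),
    ← lintegral_add_compl (μ := X.measure) _ (measurableSet_Icc (a := a) (b := b)), hXe] at hopt
  rw [revenue_eq, ← lintegral_add_compl _ (measurableSet_Icc (a := a) (b := b))] at hfin
  have e : ∫⁻ t in (Icc a b)ᶜ, ENNReal.ofReal ((1 - t) * W' t) ∂X.measure =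
      ∫⁻ t in (Icc a b)ᶜ, ENNReal.ofReal ((1 - t) * W t) ∂X.measure :=
    setLIntegral_congr_fun measurableSet_Icc.compl fun t ht => by simp only [hWe t ht]
  rw [e] at hopt
  have hle := ENNReal.le_of_add_le_add_right (ENNReal.add_ne_top.1 hfin).2 hopt
  have hnn : ∀ (F : QuantileFunction) (μ : Measure ℝ),
      0 ≤ᵐ[μ.restrict (Icc a b)] fun t => (1 - t) * F t := by
    intro F μ
    refine (ae_restrict_iff' measurableSet_Icc).2 (Filter.Eventually.of_forall fun t ht => ?_)
    exact mul_nonneg (by linarith [ht.2]) (F.nonneg t ⟨ha.trans ht.1, ht.2.trans_lt hb⟩)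
  rw [← ofReal_integral_eq_lintegral_ofReal
      (W'.integrableOn_mul ha hab hb (X'.measure_Icc_ne_top hb)) (hnn _ _),
    ← ofReal_integral_eq_lintegral_ofReal
      (W.integrableOn_mul ha hab hb (X.measure_Icc_ne_top hb)) (hnn _ _)] at hle
  exact (ENNReal.ofReal_le_ofReal_iff (integral_nonneg_of_ae (hnn _ _))).1 hle

/-- Pooling the qualities on `[a, b)` does not pay. -/
theorem pool_qualities_le (hsol : IsSolution V Q W X) {a b : ℝ} (ha : 0 ≤ a) (hab : a < b)
    (hb : b < 1) :
    (1 - a) * W a * (X.avg a b - X a) + (1 - b) * W b * X.upperShift a b ≤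
      ∫ t in Ioo a b, (1 - t) * W t ∂X.measure := by
  have h := hsol.setIntegral_le (MajorizedBy.refl W) (X.pool_majorizedBy ha hab hb).1 ha hab.le hb
    (fun _ _ => rfl) (X.measure_pool_restrict_compl ha hab hb)
  rw [setIntegral_Icc_eq hab (W.integrableOn_mul ha hab.le hb (measure_Icc_ne_top _ hb)),
    setIntegral_Icc_eq hab (W.integrableOn_mul ha hab.le hb (measure_Icc_ne_top _ hb)),
    real_pool_left, real_pool_right,
    setIntegral_measure_zero _ (X.measure_pool_Ioo ha hab hb)] at h
  linarith

/-- Pooling values and qualities on `[a, b)` does not pay. -/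
theorem pool_both_le (hsol : IsSolution V Q W X) {a b : ℝ} (ha : 0 ≤ a) (hab : a < b)
    (hb : b < 1) :
    (1 - a) * W.avg a b * (X.measure.real {a} + (X.avg a b - X a)) +
        (1 - b) * W b * X.upperShift a b ≤
      (1 - a) * W a * X.measure.real {a} + ∫ t in Ioo a b, (1 - t) * W t ∂X.measure := by
  have h := hsol.setIntegral_le (W.pool_majorizedBy ha hab hb) (X.pool_majorizedBy ha hab hb).1
    ha hab.le hb
    (fun t ht => W.pool_of_notMem ha hab hb fun h => ht (Ico_subset_Icc_self h))
    (X.measure_pool_restrict_compl ha hab hb)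
  rw [setIntegral_Icc_eq hab (integrableOn_mul _ ha hab.le hb (measure_Icc_ne_top _ hb)),
    setIntegral_Icc_eq hab (integrableOn_mul _ ha hab.le hb (measure_Icc_ne_top _ hb)),
    real_pool_left, real_pool_right,
    setIntegral_measure_zero _ (X.measure_pool_Ioo ha hab hb),
    W.pool_of_mem ha hab hb ⟨le_rfl, hab⟩, W.pool_of_ge ha hab hb le_rfl] at h
  linarith

/-- Pooling the values on `[a, b)` does not pay. -/
theorem pool_values_le (hsol : IsSolution V Q W X) {a b : ℝ} (ha : 0 ≤ a) (hab : a < b)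
    (hb : b < 1) :
    W.avg a b * ∫ t in Ico a b, (1 - t) ∂X.measure ≤
      ∫ t in Ico a b, (1 - t) * W t ∂X.measure := by
  have hi := W.integrableOn_mul ha hab.le hb (measure_Icc_ne_top X hb)
  have h := hsol.setIntegral_le (W.pool_majorizedBy ha hab hb) (MajorizedBy.refl X).1
    ha hab.le hb
    (fun t ht => W.pool_of_notMem ha hab hb fun h => ht (Ico_subset_Icc_self h)) rfl
  rw [setIntegral_Icc_eq hab (integrableOn_mul _ ha hab.le hb (measure_Icc_ne_top _ hb)),
    setIntegral_Icc_eq hab hi, W.pool_of_mem ha hab hb ⟨le_rfl, hab⟩,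
    W.pool_of_ge ha hab hb le_rfl] at h
  have e : ∫ t in Ioo a b, (1 - t) * W.pool a b ha hab hb t ∂X.measure =
      ∫ t in Ioo a b, (1 - t) * W.avg a b ∂X.measure :=
    setIntegral_congr_fun measurableSet_Ioo fun t ht => by
      simp only [W.pool_of_mem ha hab hb (Ioo_subset_Ico_self ht)]
  rw [e, integral_mul_const] at h
  rw [setIntegral_Ico_eq hab hi, setIntegral_Ico_eq hab
    (X.integrableOn_continuous hb (by fun_prop))]
  linarith

end IsSolution

/-! ### Chords -/

/-- If an upper semicontinuous function lies below its chord over `[a, b]` at `t`, then around `t`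
there is an interval on the whole of which it lies below its chord. -/
theorem exists_forall_lt_chord {G : ℝ → ℝ} {a t b : ℝ} (hat : a < t) (htb : t < b)
    (hG : ∀ s ∈ Ioo a b, UpperSemicontinuousAt G s)
    (h : (b - a) * G t < (b - t) * G a + (t - a) * G b) :
    ∃ a' b', a ≤ a' ∧ a' < t ∧ t < b' ∧ b' ≤ b ∧
      ∀ s ∈ Ioo a' b', (b' - a') * G s < (b' - s) * G a' + (s - a') * G b' := by
  have hba : 0 < b - a := by linarith
  obtain ⟨L, hL⟩ : ∃ L : ℝ → ℝ, ∀ u, L u = ((b - u) * G a + (u - a) * G b) / (b - a) :=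
    ⟨_, fun _ => rfl⟩
  have hLc : Continuous L := by
    rw [funext hL]
    fun_prop
  have hLa : L a = G a := by rw [hL]; field_simp; ring
  have hLb : L b = G b := by rw [hL]; field_simp; ring
  have hLt : G t < L t := by rw [hL, lt_div_iff₀ hba]; linarith
  -- The set where `G` is on or above the chord is closed; its points next to `t` are the endpoints.
  obtain ⟨K, hK⟩ : ∃ K : Set ℝ, ∀ u, u ∈ K ↔ (a ≤ u ∧ u ≤ b) ∧ L u ≤ G u :=
    ⟨{u | (a ≤ u ∧ u ≤ b) ∧ L u ≤ G u}, fun _ => Iff.rfl⟩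
  have hKc : IsClosed K := by
    rw [← isOpen_compl_iff, isOpen_iff_eventually]
    intro s hs
    by_cases hs1 : s ∈ Icc a b
    · have hs2 : G s < L s := by
        by_contra! h'
        exact hs ((hK s).2 ⟨hs1, h'⟩)
      have hs3 : s ∈ Ioo a b := by
        refine ⟨lt_of_le_of_ne hs1.1 ?_, lt_of_le_of_ne hs1.2 ?_⟩
        · rintro rfl; exact hs2.ne hLa.symm
        · rintro rfl; exact hs2.ne hLb.symm
      obtain ⟨y, hy1, hy2⟩ := exists_between hs2
      filter_upwards [hG s hs3 y hy1, hLc.continuousAt.eventually (lt_mem_nhds hy2)] with u h1 h2 h3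
      exact not_lt.2 ((hK u).1 h3).2 (h1.trans h2)
    · filter_upwards [isClosed_Icc.isOpen_compl.mem_nhds hs1] with u hu h3
      exact hu ((hK u).1 h3).1
  have htK : t ∉ K := fun h' => not_lt.2 ((hK t).1 h').2 hLt
  have haK : a ∈ K := (hK a).2 ⟨⟨le_rfl, by linarith⟩, hLa.le⟩
  have hbK : b ∈ K := (hK b).2 ⟨⟨by linarith, le_rfl⟩, hLb.le⟩
  have bd1 : BddAbove (K ∩ Iic t) := ⟨t, fun u hu => hu.2⟩
  have bd2 : BddBelow (K ∩ Ici t) := ⟨t, fun u hu => hu.2⟩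
  have m1 := (hKc.inter isClosed_Iic).csSup_mem ⟨a, haK, hat.le⟩ bd1
  have m2 := (hKc.inter isClosed_Ici).csInf_mem ⟨b, hbK, htb.le⟩ bd2
  set a' := sSup (K ∩ Iic t)
  set b' := sInf (K ∩ Ici t)
  have ha't : a' < t := lt_of_le_of_ne m1.2 fun e => htK (e ▸ m1.1)
  have htb' : t < b' := lt_of_le_of_ne m2.2 fun e => htK (e ▸ m2.1)
  have k1 := (hK a').1 m1.1
  have k2 := (hK b').1 m2.1
  refine ⟨a', b', k1.1.1, ha't, htb', k2.1.2, fun s hs => ?_⟩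
  have hsK : s ∉ K := by
    intro h'
    rcases le_total s t with hst | hst
    · exact not_lt.2 (le_csSup bd1 ⟨h', hst⟩) hs.1
    · exact not_lt.2 (csInf_le bd2 ⟨h', hst⟩) hs.2
  have hsL : G s < L s := by
    by_contra! h'
    exact hsK ((hK s).2 ⟨⟨k1.1.1.trans hs.1.le, hs.2.le.trans k2.1.2⟩, h'⟩)
  have haff : (b' - a') * L s = (b' - s) * L a' + (s - a') * L b' := by
    rw [hL, hL, hL]; field_simp; ring
  have h1 : (b' - a') * G s < (b' - a') * L s := by
    apply mul_lt_mul_of_pos_left hsL; linarith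
  have h2 : (b' - s) * L a' ≤ (b' - s) * G a' :=
    mul_le_mul_of_nonneg_left k1.2 (by linarith [hs.2])
  have h3 : (s - a') * L b' ≤ (s - a') * G b' :=
    mul_le_mul_of_nonneg_left k2.2 (by linarith [hs.1])
  linarith

theorem measure_eq_zero_of_setIntegral_nonpos {μ : Measure ℝ} {s : Set ℝ} {f : ℝ → ℝ}
    (hs : MeasurableSet s) (hf : IntegrableOn f s μ) (hpos : ∀ x ∈ s, 0 < f x)
    (h : ∫ x in s, f x ∂μ ≤ 0) : μ s = 0 := by
  by_contra hne
  have h0 : 0 ≤ᵐ[μ.restrict s] f :=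
    (ae_restrict_iff' hs).2 (Filter.Eventually.of_forall fun x hx => (hpos x hx).le)
  have := (setIntegral_pos_iff_support_of_nonneg_ae h0 hf).2 (by
    rw [inter_eq_right.2 (show s ⊆ Function.support f from fun x hx => (hpos x hx).ne')]
    exact pos_iff_ne_zero.2 hne)
  linarith

namespace QuantileFunction

theorem const_of_locally_const (F : QuantileFunction) {a b : ℝ} (ha : 0 ≤ a) (hb : b ≤ 1)
    (h : ∀ t ∈ Ioo a b, ∃ a' b', a' < t ∧ t < b' ∧ ∀ s ∈ Ico a' b', F s = F a') :
    ∀ t ∈ Ico a b, F t = F a := by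
  have hP : ∀ x ∈ Ioo a b, ∀ y ∈ Ioo a b, F x = F y := by
    intro x hx y hy
    refine isPreconnected_Ioo.induction₂ (fun x y => F x = F y) (fun x hx => ?_) ?_ ?_ hx hy
    · obtain ⟨a', b', h1, h2, h3⟩ := h x hx
      filter_upwards [nhdsWithin_le_nhds (Ioo_mem_nhds h1 h2)] with y hy
      rw [h3 x ⟨h1.le, h2⟩, h3 y (Ioo_subset_Ico_self hy)]
    · exact fun _ _ _ _ _ _ e1 e2 => e1.trans e2
    · exact fun _ _ _ _ e => e.symm
  intro t ht
  rcases eq_or_lt_of_le ht.1 with e | hat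
  · rw [e]
  have hc := (F.rightContinuous a ⟨ha, hat.trans (ht.2.trans_le hb)⟩).mono_left
    (nhdsWithin_mono a Ioi_subset_Ici_self)
  have hc' : Filter.Tendsto F (nhdsWithin a (Ioi a)) (nhds (F t)) := by
    refine tendsto_const_nhds.congr' ?_
    filter_upwards [Ioo_mem_nhdsGT (hat.trans ht.2)] with u hu
    exact hP t ⟨hat, ht.2⟩ u hu
  exact tendsto_nhds_unique hc' hc

theorem upperSemicontinuousAt_mul (W : QuantileFunction) {s : ℝ} (hs : s ∈ Ioo (0 : ℝ) 1) :
    UpperSemicontinuousAt (fun t => (1 - t) * W t) s := by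
  intro y hy
  have hc : ContinuousAt (fun u => (1 - u) * W (max u s)) s := by
    refine ContinuousAt.mul (by fun_prop) ?_
    have h1 : ContinuousWithinAt W (Ici s) (max s s) := by
      rw [max_self]; exact W.rightContinuous s (Ioo_subset_Ico_self hs)
    have h2 : ContinuousWithinAt (fun u => max u s) univ s := by fun_prop
    exact (continuousWithinAt_univ _ _).1 
      (ContinuousWithinAt.comp (f := fun u => max u s) h1 h2 fun u _ => le_max_right u s)
  have hev := hc.eventually (gt_mem_nhds (show (1 - s) * W (max s s) < y by simpa using hy))
  filter_upwards [hev, Ioo_mem_nhds hs.1 hs.2] with u h1 h2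
  refine lt_of_le_of_lt (mul_le_mul_of_nonneg_left ?_ (by linarith [h2.2])) h1
  exact W.mono h2.1.le (le_max_left _ _) (max_lt h2.2 hs.2)

/-! ### The quality increments weighted by `1 - t` -/

/-- The mass `∫_{[0, t)} (1 - s) dX(s)`, with the atom `X 0` at `0` included. Raising `W` by one
unit on `[a, b)` raises the revenue by `X.weight b - X.weight a`. -/
def weight (X : QuantileFunction) (t : ℝ) : ℝ := ∫ s in Ico 0 t, (1 - s) ∂X.measure

theorem weight_zero (X : QuantileFunction) : X.weight 0 = 0 := by simp [weight]

theorem integrableOn_one_sub (X : QuantileFunction) {a b : ℝ} (hb : b < 1) :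
    IntegrableOn (fun s => 1 - s) (Ico a b) X.measure :=
  (X.integrableOn_continuous hb (by fun_prop)).mono_set Ico_subset_Icc_self

theorem setIntegral_Ico_one_sub (X : QuantileFunction) {a b : ℝ} (ha : 0 ≤ a) (hab : a ≤ b)
    (hb : b < 1) : ∫ s in Ico a b, (1 - s) ∂X.measure = X.weight b - X.weight a := by
  have h := setIntegral_union (μ := X.measure) (f := fun s => 1 - s) (s := Ico 0 a) (t := Ico a b)
    (Set.disjoint_left.2 fun s hs hs' => not_lt.2 hs'.1 hs.2) measurableSet_Ico
    (X.integrableOn_one_sub (hab.trans_lt hb)) (X.integrableOn_one_sub hb)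
  rw [Ico_union_Ico_eq_Ico ha hab] at h
  simp only [weight]
  linarith

theorem weight_sub_le (X : QuantileFunction) {a b : ℝ} (ha : 0 ≤ a) (hab : a ≤ b) (hb : b < 1) :
    X.weight b - X.weight a ≤ (1 - a) * X.measure.real (Ico a b) := by
  rw [← X.setIntegral_Ico_one_sub ha hab hb]
  have := setIntegral_mono_on (μ := X.measure) (X.integrableOn_one_sub (a := a) hb)
    (integrableOn_const (X.measure_ne_top_of_subset hb fun s hs => hs.2.le) (C := 1 - a))
    measurableSet_Ico fun s hs => by linarith [hs.1]
  rw [setIntegral_const, smul_eq_mul] at this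
  linarith

theorem le_weight_sub (X : QuantileFunction) {a b : ℝ} (ha : 0 ≤ a) (hab : a ≤ b) (hb : b < 1) :
    (1 - b) * X.measure.real (Ico a b) ≤ X.weight b - X.weight a := by
  rw [← X.setIntegral_Ico_one_sub ha hab hb]
  have := setIntegral_mono_on (μ := X.measure)
    (integrableOn_const (X.measure_ne_top_of_subset hb fun s hs => hs.2.le) (C := 1 - b))
    (X.integrableOn_one_sub (a := a) hb)
    measurableSet_Ico fun s hs => by linarith [hs.2]
  rw [setIntegral_const, smul_eq_mul] at this
  linarith

theorem weight_mono (X : QuantileFunction) {a b : ℝ} (ha : 0 ≤ a) (hab : a ≤ b) (hb : b < 1) :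
    X.weight a ≤ X.weight b := by
  have h1 := X.le_weight_sub ha hab hb
  have h2 : 0 ≤ (1 - b) * X.measure.real (Ico a b) :=
    mul_nonneg (by linarith) measureReal_nonneg
  linarith

theorem upperSemicontinuousAt_neg_weight (X : QuantileFunction) {s : ℝ} (hs : s ∈ Ioo (0 : ℝ) 1) :
    UpperSemicontinuousAt (fun t => -X.weight t) s := by
  intro y hy
  simp only at hy
  have hanti : Antitone fun n : ℕ => Ico (s - 1 / ((n : ℝ) + 1)) s := fun m n hmn => by
    refine Ico_subset_Ico_left ?_
    have : 1 / ((n : ℝ) + 1) ≤ 1 / ((m : ℝ) + 1) := Nat.one_div_le_one_div hmn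
    linarith
  have hempty : ⋂ n : ℕ, Ico (s - 1 / ((n : ℝ) + 1)) s = ∅ := by
    refine eq_empty_of_forall_notMem fun u hu => ?_
    rw [mem_iInter] at hu
    obtain ⟨n, hn⟩ := exists_nat_one_div_lt (sub_pos.2 (hu 0).2)
    linarith [(hu n).1]
  have ht := tendsto_measure_iInter_atTop (μ := X.measure)
    (s := fun n : ℕ => Ico (s - 1 / ((n : ℝ) + 1)) s)
    (fun n => measurableSet_Ico.nullMeasurableSet) hanti
    ⟨0, X.measure_ne_top_of_subset hs.2 fun u hu => hu.2.le⟩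
  rw [hempty, measure_empty] at ht
  obtain ⟨n, hn⟩ := (ht.eventually (gt_mem_nhds
    (show 0 < ENNReal.ofReal (y + X.weight s) from ENNReal.ofReal_pos.2 (by linarith)))).exists
  have hp : 0 < 1 / ((n : ℝ) + 1) := by positivity
  filter_upwards [Ioo_mem_nhds hs.1 hs.2, lt_mem_nhds (show s - 1 / ((n : ℝ) + 1) < s by linarith)]
    with u hu hun
  rcases le_total s u with h | h
  · have := X.weight_mono hs.1.le h hu.2
    linarith
  · have h1 := X.weight_sub_le hu.1.le h hs.2
    have h2 : X.measure.real (Ico u s) < y + X.weight s := by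
      rw [Measure.real, ← ENNReal.lt_ofReal_iff_toReal_lt
        (X.measure_ne_top_of_subset hs.2 fun u hu => hu.2.le)]
      exact (measure_mono (Ico_subset_Ico_left hun.le)).trans_lt hn
    have h3 : (1 - u) * X.measure.real (Ico u s) ≤ X.measure.real (Ico u s) :=
      mul_le_of_le_one_left measureReal_nonneg (by linarith [hu.1])
    linarith

end QuantileFunction

namespace IsSolution
open QuantileFunction

variable {V Q W X : QuantileFunction}

/-! ### First-order conditions -/

/-- Where `(1 - t) W(t)` lies below one of its chords, the qualities are locally constant:
otherwise pooling qualities would pay. -/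
theorem qualities_const_of_lt_chord (hsol : IsSolution V Q W X) {a t b : ℝ} (ha : 0 ≤ a)
    (hat : a < t) (htb : t < b) (hb : b < 1)
    (h : (b - a) * ((1 - t) * W t) < (b - t) * ((1 - a) * W a) + (t - a) * ((1 - b) * W b)) :
    ∃ a' b', a ≤ a' ∧ a' < t ∧ t < b' ∧ b' ≤ b ∧ ∀ s ∈ Ico a' b', X s = X a' := by
  obtain ⟨a', b', h1, h2, h3, h4, h5⟩ := exists_forall_lt_chord (G := fun t => (1 - t) * W t)
    hat htb (fun s hs => W.upperSemicontinuousAt_mul ⟨ha.trans_lt hs.1, hs.2.trans hb⟩) h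
  refine ⟨a', b', h1, h2, h3, h4, ?_⟩
  have ha' := ha.trans h1
  have hb' := h4.trans_lt hb
  have hab' := h2.trans h3
  refine X.const_of_measure_Ioo_eq_zero ha' hb'.le ?_
  have i1 := X.integrableOn_Ioo (a := a') hb' (f := fun s => b' - s) (by fun_prop)
  have i2 := X.integrableOn_Ioo (a := a') hb' (f := fun s => s - a') (by fun_prop)
  have i3 : IntegrableOn (fun t => (1 - t) * W t) (Ioo a' b') X.measure :=
    (W.integrableOn_mul ha' hab'.le hb' (X.measure_Icc_ne_top hb')).mono_set Ioo_subset_Icc_self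
  have i4 : IntegrableOn (fun s => (b' - s) * ((1 - a') * W a') + (s - a') * ((1 - b') * W b'))
      (Ioo a' b') X.measure := (i1.mul_const _).add (i2.mul_const _)
  refine measure_eq_zero_of_setIntegral_nonpos measurableSet_Ioo (i4.sub (i3.const_mul (b' - a')))
    (fun s hs => by simpa using h5 s hs) ?_
  simp only [Pi.sub_apply]
  rw [integral_sub i4 (i3.const_mul _), integral_add (i1.mul_const _) (i2.mul_const _),
    integral_mul_const, integral_mul_const,
    integral_const_mul, ← X.avg_sub_mul ha' hab' hb', ← X.upperShift_mul ha' hab' hb']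
  have := mul_le_mul_of_nonneg_left (hsol.pool_qualities_le ha' hab' hb')
    (show 0 ≤ b' - a' by linarith)
  linarith

/-- Where `X.weight` lies above one of its chords, the values are locally constant: otherwise
pooling values would pay. -/
theorem values_const_of_chord_lt (hsol : IsSolution V Q W X) {a t b : ℝ} (ha : 0 ≤ a)
    (hat : a < t) (htb : t < b) (hb : b < 1)
    (h : (t - a) * (X.weight b - X.weight t) < (b - t) * (X.weight t - X.weight a)) :
    ∃ a' b', a ≤ a' ∧ a' < t ∧ t < b' ∧ b' ≤ b ∧ ∀ s ∈ Ico a' b', W s = W a' := by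
  obtain ⟨a', b', h1, h2, h3, h4, h5⟩ := exists_forall_lt_chord (G := fun t => -X.weight t)
    hat htb (fun s hs => X.upperSemicontinuousAt_neg_weight ⟨ha.trans_lt hs.1, hs.2.trans hb⟩)
    (by linarith)
  refine ⟨a', b', h1, h2, h3, h4, ?_⟩
  have ha' := ha.trans h1
  have hb' := h4.trans_lt hb
  have hab' := h2.trans h3
  refine W.const_of_measure_Ioo_eq_zero ha' hb'.le ?_
  have hfub := W.integral_mul_sub (μ := X.measure) (f := fun t => 1 - t) ha' hb'
    (X.measure_ne_top_of_subset hb' fun s hs => hs.2.le) (X.integrableOn_one_sub hb')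
  have i1 := W.integrableOn_Ioo (a := a') hb' (f := fun s => b' - s) (by fun_prop)
  have hcongr : ∀ s ∈ Ioo a' b', ∫ t in Ico s b', (1 - t) ∂X.measure =
      X.weight b' - X.weight s := fun s hs =>
    X.setIntegral_Ico_one_sub (ha'.trans hs.1.le) hs.2.le hb'
  rw [setIntegral_congr_fun measurableSet_Ioo hcongr] at hfub
  have i2 : IntegrableOn (fun s => X.weight b' - X.weight s) (Ioo a' b') W.measure := by
    have hanti : MonotoneOn X.weight (Icc a' b') := fun s hs u hu hsu =>
      X.weight_mono (ha'.trans hs.1) hsu (hu.2.trans_lt hb')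
    have := hanti.integrableOn_of_measure_ne_top (isLeast_Icc hab'.le) (isGreatest_Icc hab'.le)
      (W.measure_Icc_ne_top hb') measurableSet_Icc
    exact ((integrableOn_const (W.measure_Icc_ne_top hb')).sub this).mono_set Ioo_subset_Icc_self
  refine measure_eq_zero_of_setIntegral_nonpos measurableSet_Ioo
    ((i1.mul_const (X.weight b' - X.weight a')).sub (i2.const_mul (b' - a')))
    (fun s hs => by
      have := h5 s hs
      simp only [Pi.sub_apply]
      linarith) ?_
  simp only [Pi.sub_apply]
  rw [integral_sub (i1.mul_const _) (i2.const_mul _), integral_mul_const,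
    integral_const_mul, ← hfub, ← W.avg_sub_mul ha' hab' hb']
  have i3 : IntegrableOn (fun t => (1 - t) * W t) (Ico a' b') X.measure :=
    (W.integrableOn_mul ha' hab'.le hb' (X.measure_Icc_ne_top hb')).mono_set Ico_subset_Icc_self
  have e : ∫ t in Ico a' b', (1 - t) * (W t - W a') ∂X.measure =
      (∫ t in Ico a' b', (1 - t) * W t ∂X.measure) - (X.weight b' - X.weight a') * W a' := by
    simp only [mul_sub]
    rw [integral_sub i3 ((X.integrableOn_one_sub hb').mul_const _), integral_mul_const,
      X.setIntegral_Ico_one_sub ha' hab'.le hb']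
  have hle := hsol.pool_values_le ha' hab' hb'
  rw [X.setIntegral_Ico_one_sub ha' hab'.le hb'] at hle
  rw [e]
  have := mul_le_mul_of_nonneg_left hle (show 0 ≤ b' - a' by linarith)
  linarith

/-! ### Values and qualities are constant on the same intervals -/

/-- Served quantiles with constant quality also have constant expected value. -/
theorem values_const (hsol : IsSolution V Q W X) {a b : ℝ} (ha : 0 ≤ a) (hb : b ≤ 1)
    (hX : ∀ t ∈ Ico a b, X t = X a) (hpos : 0 < X a) : ∀ t ∈ Ico a b, W t = W a := by
  refine W.const_of_locally_const ha hb fun t ht => ?_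
  obtain ⟨b₀, hb1, hb2⟩ := exists_between ht.2
  have hb₀ : b₀ < 1 := hb2.trans_le hb
  have h0t : 0 < t := ha.trans_lt ht.1
  have h1 : X.weight b₀ - X.weight t = 0 := by
    rw [← X.setIntegral_Ico_one_sub h0t.le hb1.le hb₀]
    refine setIntegral_measure_zero _ (measure_mono_null (t := Ioo a b₀)
      (fun s hs => ⟨ht.1.trans_le hs.1, hs.2⟩) ?_)
    exact X.measure_Ioo_eq_zero_of_const ha hb₀ fun s hs => hX s ⟨hs.1, hs.2.trans hb2⟩
  have h2 : 0 < X.weight t - X.weight 0 := by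
    have h3 := X.le_weight_sub le_rfl h0t.le (hb1.trans hb₀)
    have h4 : X a ≤ X.measure.real (Ico 0 t) := by
      rw [← X.real_Ico_zero ha (ht.1.trans (hb1.trans hb₀)), ← measureReal_union (by simp)
        (measurableSet_singleton a)
        (X.measure_ne_top_of_subset (ht.1.trans (hb1.trans hb₀)) fun s hs => hs.2.le)
        (X.measure_ne_top_of_subset (ht.1.trans (hb1.trans hb₀)) (by simp)),
        Ico_union_right ha]
      exact measureReal_mono (fun s hs => ⟨hs.1, hs.2.trans_lt ht.1⟩)
        (X.measure_ne_top_of_subset (hb1.trans hb₀) fun s hs => hs.2.le)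
    have h5 : 0 < (1 - t) * X.measure.real (Ico 0 t) :=
      mul_pos (by linarith) (hpos.trans_le h4)
    linarith
  obtain ⟨a', b', -, h5, h6, -, h7⟩ := hsol.values_const_of_chord_lt le_rfl h0t hb1 hb₀ (by
    rw [h1, mul_zero]
    exact mul_pos (by linarith) h2)
  exact ⟨a', b', h5, h6, h7⟩

/-- Quantiles with constant expected value below its maximum also have constant quality. -/
theorem qualities_const (hsol : IsSolution V Q W X) {a b b₀ : ℝ} (ha : 0 ≤ a) (hb₀ : b₀ < 1)
    (hW : ∀ t ∈ Ico a b, W t = W a) (hlt : W a < W b₀) (hab₀ : a < b₀) :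
    ∀ t ∈ Ico a b, X t = X a := by
  have hbb : b ≤ b₀ := by
    by_contra! h
    exact hlt.ne (hW b₀ ⟨hab₀.le, h⟩).symm
  refine X.const_of_locally_const ha (hbb.trans hb₀.le) fun t ht => ?_
  have htb : t < b₀ := ht.2.trans_le hbb
  obtain ⟨a', b', -, h5, h6, -, h7⟩ := hsol.qualities_const_of_lt_chord ha ht.1 htb hb₀ (by
    rw [hW t (Ioo_subset_Ico_self ht)]
    have : 0 < (t - a) * ((1 - b₀) * (W b₀ - W a)) :=
      mul_pos (by linarith [ht.1]) (mul_pos (by linarith) (by linarith))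
    nlinarith)
  exact ⟨a', b', h5, h6, h7⟩

end IsSolution

/-! ### Maximal pooling intervals -/

theorem QuantileFunction.exists_forall_lt (F : QuantileFunction) {t c : ℝ} (h0 : 0 ≤ t)
    (h1 : t < 1) (h : F t < c) : ∃ u, t < u ∧ u < 1 ∧ ∀ s ∈ Ico t u, F s < c := by
  have hev := (F.rightContinuous t ⟨h0, h1⟩).eventually (gt_mem_nhds h)
  obtain ⟨u, hu, hsub⟩ := (mem_nhdsGE_iff_exists_Ico_subset' h1).1 hev
  obtain ⟨v, hv1, hv2⟩ := exists_between (lt_min hu h1)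
  exact ⟨v, hv1, hv2.trans_le (min_le_right _ _), fun s hs =>
    hsub ⟨hs.1, hs.2.trans (hv2.trans_le (min_le_left _ _))⟩⟩

theorem QuantileFunction.tendsto_nhdsGT (F : QuantileFunction) {t : ℝ} (h0 : 0 ≤ t) (h1 : t < 1) :
    Filter.Tendsto F (nhdsWithin t (Ioi t)) (nhds (F t)) :=
  (F.rightContinuous t ⟨h0, h1⟩).mono_left (nhdsWithin_mono t Ioi_subset_Ici_self)

/-- `[p, q)` is a pooling interval below the top one: `W` and `X` are constant on it, `X` jumps
at `p` (with the convention `X = 0` to the left of `0`), and `W` jumps at `q`. -/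
structure IsPoolingInterval (W X : QuantileFunction) (p q : ℝ) : Prop where
  nonneg : 0 ≤ p
  lt : p < q
  lt_one : q < 1
  values : ∀ t ∈ Ico p q, W t = W p
  qualities : ∀ t ∈ Ico p q, X t = X p
  atom : 0 < X.measure.real {p}
  jump : W p < W q

namespace IsPoolingInterval

variable {W X : QuantileFunction} {p q p' q' : ℝ}

theorem measure_Ioo (h : IsPoolingInterval W X p q) : X.measure (Ioo p q) = 0 :=
  X.measure_Ioo_eq_zero_of_const h.nonneg h.lt_one h.qualities

theorem real_right (h : IsPoolingInterval W X p q) : X.measure.real {q} = X q - X p := by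
  rw [← X.real_Ioo h.nonneg h.lt h.lt_one, Measure.real, Measure.real, h.measure_Ioo]
  simp

theorem quality_pos (h : IsPoolingInterval W X p q) : 0 < X p := by
  have h1 := X.real_Ico_zero h.nonneg (h.lt.trans h.lt_one)
  have h2 : 0 ≤ X.measure.real (Ico 0 p) := measureReal_nonneg
  linarith [h.atom]

theorem eq_or_le (h : IsPoolingInterval W X p q) (h' : IsPoolingInterval W X p' q')
    (hpp : p ≤ p') : (p = p' ∧ q = q') ∨ q ≤ p' := by
  rcases eq_or_lt_of_le hpp with rfl | hlt
  · refine Or.inl ⟨rfl, le_antisymm ?_ ?_⟩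
    · by_contra! hq
      exact h'.jump.ne' (h.values q' ⟨h'.lt.le, hq⟩)
    · by_contra! hq
      exact h.jump.ne' (h'.values q ⟨h.lt.le, hq⟩)
  · refine Or.inr ?_
    by_contra! hq
    have h0 : X.measure {p'} = 0 :=
      measure_mono_null (t := Ioo p q) (singleton_subset_iff.2 ⟨hlt, hq⟩) h.measure_Ioo
    have := h'.atom
    simp [Measure.real, h0] at this

end IsPoolingInterval

namespace IsSolution
open QuantileFunction

variable {V Q W X : QuantileFunction}

/-- A served quantile below the top pool to the right of which the expected value is locally
constant lies in a pooling interval. -/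
theorem exists_isPoolingInterval (hsol : IsSolution V Q W X) {t d b : ℝ} (h0 : 0 ≤ t) (htd : t < d)
    (hb : b < 1) (htb : t < b) (hX : 0 < X t) (hWb : W t < W b)
    (hc : ∀ s ∈ Ico t d, W s = W t) :
    ∃ p q, X p = X t ∧ p ≤ t ∧ t < q ∧ q ≤ b ∧ IsPoolingInterval W X p q := by
  have ht1 : t < 1 := htb.trans hb
  obtain ⟨S, hS⟩ : ∃ S : Set ℝ, ∀ s, s ∈ S ↔ (0 ≤ s ∧ s ≤ t) ∧ X s = X t :=
    ⟨{s | (0 ≤ s ∧ s ≤ t) ∧ X s = X t}, fun _ => Iff.rfl⟩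
  obtain ⟨T, hT⟩ : ∃ T : Set ℝ, ∀ s, s ∈ T ↔ (t ≤ s ∧ s ≤ b) ∧ W t < W s :=
    ⟨{s | (t ≤ s ∧ s ≤ b) ∧ W t < W s}, fun _ => Iff.rfl⟩
  have htS : t ∈ S := (hS t).2 ⟨⟨h0, le_rfl⟩, rfl⟩
  have hbT : b ∈ T := (hT b).2 ⟨⟨htb.le, le_rfl⟩, hWb⟩
  have hSb : BddBelow S := ⟨0, fun s hs => ((hS s).1 hs).1.1⟩
  have hTb : BddBelow T := ⟨t, fun s hs => ((hT s).1 hs).1.1⟩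
  have hp0 : 0 ≤ sInf S := le_csInf ⟨t, htS⟩ fun s hs => ((hS s).1 hs).1.1
  have hpt : sInf S ≤ t := csInf_le hSb htS
  have hdq : d ≤ sInf T := le_csInf ⟨b, hbT⟩ fun s hs => by
    by_contra! h
    exact ((hT s).1 hs).2.ne (hc s ⟨((hT s).1 hs).1.1, h⟩).symm
  have hqb : sInf T ≤ b := csInf_le hTb hbT
  have hp_min : ∀ s, 0 ≤ s → X s = X t → sInf S ≤ s := by
    intro s hs1 hs2
    rcases le_total s t with h | h
    · exact csInf_le hSb ((hS s).2 ⟨⟨hs1, h⟩, hs2⟩)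
    · exact hpt.trans h
  have hq_ex : ∀ u, sInf T < u → ∃ s, s < u ∧ sInf T ≤ s ∧ W t < W s := by
    intro u hu
    obtain ⟨s, hs, hsu⟩ := exists_lt_of_csInf_lt ⟨b, hbT⟩ hu
    exact ⟨s, hsu, csInf_le hTb hs, ((hT s).1 hs).2⟩
  have hXp : X (sInf S) = X t := by
    refine le_antisymm (X.mono hp0 hpt ht1) ?_
    by_contra! h
    obtain ⟨u, hu1, -, hu2⟩ := X.exists_forall_lt hp0 (hpt.trans_lt ht1) h
    obtain ⟨s, hs, hsu⟩ := exists_lt_of_csInf_lt ⟨t, htS⟩ hu1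
    exact (hu2 s ⟨csInf_le hSb hs, hsu⟩).ne ((hS s).1 hs).2
  have hWc : ∀ s ∈ Ico t (sInf T), W s = W t := by
    intro s hs
    refine le_antisymm ?_ (W.mono h0 hs.1 (hs.2.trans_le (hqb.trans hb.le)))
    by_contra! h
    exact not_le.2 hs.2 (csInf_le hTb ((hT s).2 ⟨⟨hs.1, hs.2.le.trans hqb⟩, h⟩))
  have hXc := hsol.qualities_const h0 hb hWc hWb htb
  set p := sInf S
  set q := sInf T
  have htq : t < q := htd.trans_le hdq
  have hq1 : q < 1 := hqb.trans_lt hb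
  have hXc' : ∀ s ∈ Ico p q, X s = X p := by
    intro s hs
    rw [hXp]
    rcases le_total t s with h | h
    · exact hXc s ⟨h, hs.2⟩
    · exact le_antisymm (X.mono (hp0.trans hs.1) h ht1)
        (hXp ▸ X.mono hp0 hs.1 (hs.2.trans hq1))
  have hXp0 : 0 < X p := hXp ▸ hX
  have hWc' := hsol.values_const hp0 hq1.le hXc' hXp0
  have hWp : W p = W t := (hWc' t ⟨hpt, htq⟩).symm
  have hpq : p < q := hpt.trans_lt htq
  refine ⟨p, q, hXp, hpt, htq, hqb, hp0, hpq, hq1, hWc', hXc', ?_, ?_⟩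
  · refine lt_of_le_of_ne measureReal_nonneg fun h => ?_
    have hpX := X.real_Ico_zero hp0 (hpq.trans hq1)
    rw [← h, add_zero] at hpX
    rcases eq_or_lt_of_le hp0 with e | hp0'
    · rw [← e] at hpX
      simp only [Ico_self, measureReal_empty] at hpX
      rw [← e] at hXp0
      linarith
    · obtain ⟨m, hm1, hm2⟩ := exists_between hpq
      have h1 : X.weight m - X.weight p = 0 := by
        rw [← X.setIntegral_Ico_one_sub hp0 hm1.le (hm2.trans hq1)]
        refine setIntegral_measure_zero _ ?_
        rw [← Ioo_insert_left hm1, ← singleton_union]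
        refine measure_union_null ?_ ?_
        · exact (measureReal_eq_zero_iff
            (X.measure_ne_top_of_subset (hpq.trans hq1) (by simp))).1 h.symm
        · exact X.measure_Ioo_eq_zero_of_const hp0 (hm2.trans hq1)
            fun s hs => hXc' s ⟨hs.1, hs.2.trans hm2⟩
      have h2 := X.le_weight_sub le_rfl hp0 (hpq.trans hq1)
      rw [hpX] at h2
      have h3 : 0 < (1 - p) * X p := mul_pos (by linarith) hXp0
      obtain ⟨a', b', ha0, h4, h5, -, h6⟩ := hsol.values_const_of_chord_lt le_rfl hp0' hm1
        (hm2.trans hq1) (by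
          rw [h1, mul_zero]
          exact mul_pos (by linarith) (by linarith))
      have h7 := hsol.qualities_const ha0 hb h6 (by
        rw [← h6 p ⟨h4.le, h5⟩, hWp]; exact hWb) (h4.trans_le (hpt.trans htb.le))
      have h8 := hp_min a' ha0 (by rw [← hXp, h7 p ⟨h4.le, h5⟩])
      linarith
  · refine lt_of_le_of_ne (W.mono hp0 hpq.le hq1) fun h => ?_
    have hqb' : q < b := lt_of_le_of_ne hqb fun e => by
      rw [e, hWp] at h
      exact hWb.ne h
    obtain ⟨a', b', ha', h4, h5, hb', h6⟩ := hsol.qualities_const_of_lt_chord hp0 hpq hqb' hb (by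
      rw [← h]
      have : 0 < (q - p) * ((1 - b) * (W b - W p)) :=
        mul_pos (by linarith) (mul_pos (by linarith) (by linarith))
      nlinarith)
    have h7 : ∀ s ∈ Ico p b', X s = X p := by
      intro s hs
      rcases lt_or_ge s q with h' | h'
      · exact hXc' s ⟨hs.1, h'⟩
      · rw [h6 s ⟨h4.le.trans h', hs.2⟩, hXc' a' ⟨ha', h4⟩]
    have h8 := hsol.values_const hp0 (hb'.trans hb.le) h7 hXp0
    obtain ⟨s, hs1, hs2, hs3⟩ := hq_ex b' h5
    rw [h8 s ⟨hpq.le.trans hs2, hs1⟩, hWp] at hs3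
    exact lt_irrefl _ hs3

/-- A weak consequence of `IsSolution.pool_both_le`: the gain at an atom of the qualities at `a` is
at most the cost of the mass that moves down to `a`. -/
theorem avg_sub_mul_atom_le (hsol : IsSolution V Q W X) {a b : ℝ} (ha : 0 ≤ a) (hab : a < b)
    (hb : b < 1) : (W.avg a b - W a) * X.measure.real {a} ≤
      (W b - W.avg a b) * (X.avg a b - X a) := by
  have h := hsol.pool_both_le ha hab hb
  have i3 : IntegrableOn (fun t => (1 - t) * W t) (Ioo a b) X.measure :=
    (W.integrableOn_mul ha hab.le hb (X.measure_Icc_ne_top hb)).mono_set Ioo_subset_Icc_self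
  have i4 : IntegrableOn (fun t => 1 - t) (Ioo a b) X.measure := X.integrableOn_Ioo hb (by fun_prop)
  have h1 : ∫ t in Ioo a b, (1 - t) * W t ∂X.measure ≤
      ((1 - a) * (X.avg a b - X a) + (1 - b) * X.upperShift a b) * W b := by
    rw [← X.integral_one_sub ha hab hb, ← integral_mul_const]
    refine setIntegral_mono_on i3 (i4.mul_const _) measurableSet_Ioo fun t ht => ?_
    exact mul_le_mul_of_nonneg_left (W.mono (ha.trans ht.1.le) ht.2.le hb) (by linarith [ht.2])
  refine le_of_mul_le_mul_left ?_ (show 0 < 1 - a by linarith)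
  nlinarith

/-- A pooling interval `[p, q)` below the top pool is followed by an adjacent one `[q, q')`. The
jump of the qualities is larger at `q` than at `p`, and the jump of the values, weighted by
`1 - t`, is larger at `q` than at `q'`: these are the first-order conditions for extending the
left interval to the right, and the right interval to the left. -/
theorem exists_next (hsol : IsSolution V Q W X) {p q b : ℝ} (hg : IsPoolingInterval W X p q)
    (hqb : q < b) (hb : b < 1) (hWb : W q < W b) :
    X.measure.real {p} ≤ X.measure.real {q} ∧ ∃ q', IsPoolingInterval W X q q' ∧
      (1 - q') * (W q' - W q) ≤ (1 - q) * (W q - W p) := by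
  have hq0 : 0 ≤ q := hg.nonneg.trans hg.lt.le
  have hω : 0 < W q - W p := sub_pos.2 hg.jump
  have hatom : X.measure.real {p} ≤ X.measure.real {q} := by
    have hev : ∀ b' ∈ Ioo q b, (W q - W p) * X.measure.real {p} ≤ (W b' - W p) * (X b' - X p) := by
      intro b' hb'
      have hb1 : b' < 1 := hb'.2.trans hb
      have hpb : p < b' := hg.lt.trans hb'.1
      have h1 := hsol.avg_sub_mul_atom_le hg.nonneg hpb hb1
      have h2 := W.le_avg_of_mem hg.nonneg hg.lt.le hb'.1 hb1.le
      have h3 := X.avg_le_of_const hg.nonneg hg.lt.le hb'.1 hb1 hg.qualities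
      have h4 := W.le_avg hg.nonneg hpb hb1.le
      have h4' := W.avg_le hg.nonneg hpb hb1
      have h5 := X.mono hg.nonneg hpb.le hb1
      have e1 : (b' - q) * ((W q - W p) * X.measure.real {p}) ≤
          (b' - p) * ((W.avg p b' - W p) * X.measure.real {p}) := by
        have := mul_le_mul_of_nonneg_right h2 hg.atom.le
        linarith
      have e2 : (b' - p) * ((W.avg p b' - W p) * X.measure.real {p}) ≤
          (b' - p) * ((W b' - W.avg p b') * (X.avg p b' - X p)) :=
        mul_le_mul_of_nonneg_left h1 (by linarith)
      have e3 : (W b' - W.avg p b') * ((b' - p) * (X.avg p b' - X p)) ≤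
          (W b' - W.avg p b') * ((b' - q) * (X b' - X p)) :=
        mul_le_mul_of_nonneg_left h3 (by linarith)
      have e4 : (W b' - W.avg p b') * ((b' - q) * (X b' - X p)) ≤
          (W b' - W p) * ((b' - q) * (X b' - X p)) :=
        mul_le_mul_of_nonneg_right (by linarith)
          (mul_nonneg (by linarith [hb'.1]) (by linarith))
      refine le_of_mul_le_mul_left ?_ (show 0 < b' - q by linarith [hb'.1])
      linarith
    have hlim := (((W.tendsto_nhdsGT hq0 hg.lt_one).sub_const (W p)).mul
      ((X.tendsto_nhdsGT hq0 hg.lt_one).sub_const (X p)))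
    have hle := ge_of_tendsto hlim (Filter.eventually_of_mem (Ioo_mem_nhdsGT hqb) hev)
    rw [hg.real_right]
    exact le_of_mul_le_mul_left hle hω
  have hatomq : 0 < X.measure.real {q} := hg.atom.trans_le hatom
  refine ⟨hatom, ?_⟩
  -- To the right of the atom at `q` the weight is above its chords, so that `W` is constant there.
  obtain ⟨η, hη⟩ : ∃ η, η = (1 - b) * X.measure.real {q} := ⟨_, rfl⟩
  have hη0 : 0 < η := hη ▸ mul_pos (by linarith) hatomq
  have hwb : 0 ≤ X.weight b := X.weight_zero ▸ X.weight_mono le_rfl (hq0.trans hqb.le) hb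
  obtain ⟨d, hd⟩ : ∃ d, d = q + (b - q) * η / (X.weight b + η) := ⟨_, rfl⟩
  have hqd : q < d := by
    have : 0 < (b - q) * η / (X.weight b + η) :=
      div_pos (mul_pos (by linarith) hη0) (by linarith)
    linarith
  have hdb : d ≤ b := by
    have : (b - q) * η / (X.weight b + η) ≤ b - q := by
      rw [div_le_iff₀ (by linarith)]
      nlinarith [mul_nonneg (sub_nonneg.2 hqb.le) hwb]
    linarith
  have hconst : ∀ t ∈ Ico q d, W t = W q := by
    refine W.const_of_locally_const hq0 (hdb.trans hb.le) fun t ht => ?_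
    have htb : t < b := ht.2.trans_le hdb
    have h1 : η ≤ X.weight t - X.weight q := by
      refine le_trans ?_ (X.le_weight_sub hq0 ht.1.le (htb.trans hb))
      rw [hη]
      refine mul_le_mul (by linarith) (measureReal_mono (by simpa using ht.1)
        (X.measure_ne_top_of_subset (htb.trans hb) fun s hs => hs.2.le)) measureReal_nonneg
        (by linarith)
    have h2 : 0 ≤ X.weight t :=
      X.weight_zero ▸ X.weight_mono le_rfl (hq0.trans ht.1.le) (htb.trans hb)
    have h3 : (t - q) * (X.weight b + η) < (b - q) * η := by
      rw [← lt_div_iff₀ (by linarith)]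
      linarith [ht.2]
    obtain ⟨a', b', -, h4, h5, -, h6⟩ := hsol.values_const_of_chord_lt hq0 ht.1 htb hb (by
      have h7 : (t - q) * (X.weight b - X.weight t) ≤ (t - q) * X.weight b :=
        mul_le_mul_of_nonneg_left (by linarith) (by linarith [ht.1])
      have h8 : (b - t) * η ≤ (b - t) * (X.weight t - X.weight q) :=
        mul_le_mul_of_nonneg_left h1 (by linarith)
      linarith)
    exact ⟨a', b', h4, h5, h6⟩
  have hXq : 0 < X q := hg.quality_pos.trans_le (X.mono hg.nonneg hg.lt.le hg.lt_one)
  obtain ⟨p', q', -, hp'q, hqq', -, hg'⟩ :=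
    hsol.exists_isPoolingInterval hq0 hqd hb hqb hXq hWb hconst
  have hp' : p' = q := by
    refine le_antisymm hp'q ?_
    by_contra! h
    have h0 : X.measure {q} = 0 :=
      measure_mono_null (t := Ioo p' q') (singleton_subset_iff.2 ⟨h, hqq'⟩) hg'.measure_Ioo
    simp [Measure.real, h0] at hatomq
  rw [hp'] at hg'
  refine ⟨q', hg', ?_⟩
  -- Pool on `[a, q')` for some `a` in the interior of `[p, q)`; the only mass there is at `q`.
  obtain ⟨a, ha1, ha2⟩ := exists_between hg.lt
  have ha0 : 0 ≤ a := hg.nonneg.trans ha1.le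
  have haq' : a < q' := ha2.trans hqq'
  have hset : Ioo a q' =ᵐ[X.measure] ({q} : Set ℝ) := by
    rw [ae_eq_set]
    refine ⟨measure_mono_null (t := Ioo p q ∪ Ioo q q') ?_
      (measure_union_null hg.measure_Ioo hg'.measure_Ioo), ?_⟩
    · rintro s ⟨hs1, hs2⟩
      rcases lt_trichotomy s q with h | h | h
      · exact Or.inl ⟨ha1.trans hs1.1, h⟩
      · exact absurd h hs2
      · exact Or.inr ⟨h, hs1.2⟩
    · refine measure_mono_null (t := ∅) ?_ measure_empty
      rintro s ⟨hs1, hs2⟩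
      rw [mem_singleton_iff.1 hs1] at hs2
      exact hs2 ⟨ha2, hqq'⟩
  have hint : ∀ f : ℝ → ℝ, ∫ t in Ioo a q', f t ∂X.measure = X.measure.real {q} * f q := by
    intro f
    rw [setIntegral_congr_set hset, integral_singleton, smul_eq_mul]
  have h1 := hsol.pool_both_le ha0 haq' hg'.lt_one
  have hA := X.avg_sub_mul ha0 haq' hg'.lt_one
  have hB := X.upperShift_mul ha0 haq' hg'.lt_one
  have hW := W.le_avg_of_mem ha0 ha2.le hqq' hg'.lt_one.le
  have hatoma : X.measure.real {a} = 0 := by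
    rw [Measure.real, measure_mono_null (t := Ioo p q) (singleton_subset_iff.2 ⟨ha1, ha2⟩)
      hg.measure_Ioo]
    rfl
  rw [hint] at h1 hA hB
  rw [hatoma, mul_zero, zero_add, zero_add] at h1
  rw [hg.values a ⟨ha1.le, ha2⟩] at hW
  have hH : 0 < q' - a := by linarith
  have h2 : (1 - a) * W.avg a q' * (q' - q) + (1 - q') * W q' * (q - a) ≤
      (q' - a) * ((1 - q) * W q) := by
    refine le_of_mul_le_mul_left ?_ hatomq
    have := mul_le_mul_of_nonneg_left h1 hH.le
    calc X.measure.real {q} * ((1 - a) * W.avg a q' * (q' - q) + (1 - q') * W q' * (q - a))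
        = (1 - a) * W.avg a q' * ((q' - a) * (X.avg a q' - X a)) +
          (1 - q') * W q' * ((q' - a) * X.upperShift a q') := by rw [hA, hB]; ring
      _ ≤ _ := by linarith
  have h3 : (q - a) * ((1 - q') * (W q' - W q)) ≤ (q' - q) * (1 - a) * (W q - W.avg a q') := by
    linarith
  have h4 : (q' - a) * (W q - W.avg a q') ≤ (q - a) * (W q - W p) := by linarith
  have h5 : (q' - q) * (1 - a) ≤ (q' - a) * (1 - q) := by
    nlinarith [mul_nonneg (sub_nonneg.2 ha2.le) (sub_nonneg.2 hg'.lt_one.le)]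
  have h6 : (q' - q) * (1 - a) * ((q' - a) * (W q - W.avg a q')) ≤
      (q' - q) * (1 - a) * ((q - a) * (W q - W p)) :=
    mul_le_mul_of_nonneg_left h4 (mul_nonneg (by linarith) (by linarith [hg.lt_one]))
  have h7 : (q' - q) * (1 - a) * ((q - a) * (W q - W p)) ≤
      (q' - a) * (1 - q) * ((q - a) * (W q - W p)) :=
    mul_le_mul_of_nonneg_right h5 (mul_nonneg (by linarith) hω.le)
  have h8 := mul_le_mul_of_nonneg_left h3 hH.le
  refine le_of_mul_le_mul_left ?_ (mul_pos hH (show 0 < q - a by linarith))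
  linarith

/-- Iterating `IsSolution.exists_next` from one pooling interval leads to any other one to its
right, because each step raises the quality by at least the fixed amount `c`. Hence the weighted
jumps of the values decrease along pooling intervals. -/
theorem jump_le_jump (hsol : IsSolution V Q W X) {p₁ q₁ c : ℝ} (hg₁ : IsPoolingInterval W X p₁ q₁)
    (n : ℕ) : ∀ p q : ℝ, IsPoolingInterval W X p q → q ≤ p₁ →
      c ≤ X.measure.real {p} → X p₁ - X p < n * c →
      (1 - q₁) * (W q₁ - W p₁) ≤ (1 - q) * (W q - W p) := by
  induction n with
  | zero =>
    intro p q hg hq _ h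
    have := X.mono hg.nonneg (hg.lt.le.trans hq) (hg₁.lt.trans hg₁.lt_one)
    simp only [Nat.cast_zero, zero_mul] at h
    linarith
  | succ n ih =>
    intro p q hg hq hcp h
    have hWq := W.mono (hg.nonneg.trans hg.lt.le) hq (hg₁.lt.trans hg₁.lt_one)
    obtain ⟨hat, q', hg', hle⟩ := hsol.exists_next hg (hq.trans_lt hg₁.lt) hg₁.lt_one
      (hWq.trans_lt hg₁.jump)
    rcases hg'.eq_or_le hg₁ hq with ⟨e1, e2⟩ | hq'
    · rw [← e1, ← e2]
      exact hle
    · refine (ih q q' hg' hq' (hcp.trans hat) ?_).trans hle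
      have := hg.real_right
      push_cast at h
      linarith

/-! ### No interval of full separation -/

/-- Values and qualities are not both strictly increasing on an interval. Otherwise the first-order
conditions hold at all its points. To the right of any point `c`, on a suitable small scale `[c,
b)`, they make `W` nearly linear, and `X.weight` linear up to a factor of `2`. As `W` is nearly
linear, pooling `X` alone on `[c, b)` costs little. Pooling `W` as well then gains `W.avg c b - W c`
for each unit of mass that is at `c`, and by the bounds on `X.weight` this mass is not small. -/
theorem not_strictMono (hsol : IsSolution V Q W X) {t₀ u : ℝ} (h0 : 0 ≤ t₀) (htu : t₀ < u)
    (hu : u < 1) (hW : ∀ a b, t₀ < a → a < b → b < u → W a < W b)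
    (hX : ∀ a b, t₀ < a → a < b → b < u → X a < X b) : False := by
  have chordW : ∀ a t b, 0 ≤ a → a < t → t < b → b < 1 → t₀ < t → t < u →
      (b - t) * ((1 - a) * W a) + (t - a) * ((1 - b) * W b) ≤ (b - a) * ((1 - t) * W t) := by
    intro a t b ha hat htb hb h1 h2
    by_contra! h
    obtain ⟨a', b', -, h4, h5, -, h6⟩ := hsol.qualities_const_of_lt_chord ha hat htb hb h
    obtain ⟨s, hs1, hs2⟩ := exists_between (lt_min h5 h2)
    have := hX t s h1 hs1 (hs2.trans_le (min_le_right _ _))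
    rw [h6 t ⟨h4.le, h5⟩, h6 s ⟨(h4.trans hs1).le, hs2.trans_le (min_le_left _ _)⟩] at this
    exact lt_irrefl _ this
  have chordX : ∀ a t b, 0 ≤ a → a < t → t < b → b < 1 → t₀ < t → t < u →
      (b - t) * (X.weight t - X.weight a) ≤ (t - a) * (X.weight b - X.weight t) := by
    intro a t b ha hat htb hb h1 h2
    by_contra! h
    obtain ⟨a', b', -, h4, h5, -, h6⟩ := hsol.values_const_of_chord_lt ha hat htb hb h
    obtain ⟨s, hs1, hs2⟩ := exists_between (lt_min h5 h2)
    have := hW t s h1 hs1 (hs2.trans_le (min_le_right _ _))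
    rw [h6 t ⟨h4.le, h5⟩, h6 s ⟨(h4.trans hs1).le, hs2.trans_le (min_le_left _ _)⟩] at this
    exact lt_irrefl _ this
  obtain ⟨c, hc1, hc2⟩ := exists_between htu
  obtain ⟨a₀, ha1, ha2⟩ := exists_between hc1
  have hc0 : 0 ≤ c := h0.trans hc1.le
  have ha0 : 0 ≤ a₀ := h0.trans ha1.le
  have hc1' : 0 < 1 - c := by linarith
  obtain ⟨u₁, hu₁⟩ : ∃ u₁, u₁ = (c + u) / 2 := ⟨_, rfl⟩
  have hcu₁ : c < u₁ := by linarith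
  have hu₁u : u₁ < u := by linarith
  -- The slopes of `b ↦ (1 - b) (W b - W c)` from `c` decrease in `b`, so that their supremum `k` is
  -- the right derivative at `c`, and all slopes up to a suitable point `u₀` are close to `k`.
  obtain ⟨R, hR⟩ : ∃ R : Set ℝ, ∀ x, x ∈ R ↔
      ∃ b, (c < b ∧ b ≤ u₁) ∧ x * (b - c) = (1 - b) * (W b - W c) :=
    ⟨{x | ∃ b, (c < b ∧ b ≤ u₁) ∧ x * (b - c) = (1 - b) * (W b - W c)}, fun _ => Iff.rfl⟩
  have hRmem : ∀ b, c < b → b ≤ u₁ → (1 - b) * (W b - W c) / (b - c) ∈ R := by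
    intro b hb1 hb2
    refine (hR _).2 ⟨b, ⟨hb1, hb2⟩, div_mul_cancel₀ _ (by linarith)⟩
  have hRb : BddAbove R := by
    refine ⟨(1 - a₀) * (W c - W a₀) / (c - a₀), fun x hx => ?_⟩
    obtain ⟨b, ⟨hb1, hb2⟩, hb3⟩ := (hR x).1 hx
    have h1 := chordW a₀ c b ha0 ha2 hb1 (by linarith) hc1 hc2
    rw [le_div_iff₀ (by linarith)]
    refine le_of_mul_le_mul_left ?_ (show 0 < b - c by linarith)
    calc (b - c) * (x * (c - a₀)) = (c - a₀) * (x * (b - c)) := by ring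
      _ = (c - a₀) * ((1 - b) * (W b - W c)) := by rw [hb3]
      _ ≤ _ := by linarith
  have hk0 : 0 < sSup R := by
    refine lt_of_lt_of_le ?_ (le_csSup hRb (hRmem u₁ hcu₁ le_rfl))
    exact div_pos (mul_pos (by linarith) (sub_pos.2 (hW c u₁ hc1 hcu₁ hu₁u))) (by linarith)
  obtain ⟨x, hxR, hx⟩ := exists_lt_of_lt_csSup ⟨_, hRmem u₁ hcu₁ le_rfl⟩
    (show 127 / 128 * sSup R < sSup R by linarith)
  obtain ⟨u₀, ⟨hu1, hu2⟩, hu3⟩ := (hR x).1 hxR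
  have hWup : ∀ b, c < b → b ≤ u₁ → (1 - b) * (W b - W c) ≤ sSup R * (b - c) := by
    intro b hb1 hb2
    have := le_csSup hRb (hRmem b hb1 hb2)
    rwa [div_le_iff₀ (by linarith)] at this
  have hWlow : ∀ b, c < b → b ≤ u₀ →
      127 / 128 * sSup R * (b - c) ≤ (1 - b) * (W b - W c) := by
    intro b hb1 hb2
    have h1 : x * (b - c) ≤ (1 - b) * (W b - W c) := by
      rcases eq_or_lt_of_le hb2 with rfl | hb2
      · exact hu3.le
      have h2 := chordW c b u₀ hc0 hb1 hb2 (by linarith) (by linarith) (by linarith)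
      refine le_of_mul_le_mul_left ?_ (show 0 < u₀ - c by linarith)
      calc (u₀ - c) * (x * (b - c)) = (b - c) * (x * (u₀ - c)) := by ring
        _ = (b - c) * ((1 - u₀) * (W u₀ - W c)) := by rw [hu3]
        _ ≤ _ := by linarith
    exact (mul_le_mul_of_nonneg_right hx.le (by linarith)).trans h1
  obtain ⟨k, hk⟩ : ∃ k, k = sSup R := ⟨_, rfl⟩
  rw [← hk] at hk0 hWup hWlow
  -- `l` is the infimum of the slopes of the weight to the right of `c`, which is attained up to a
  -- factor of `2` at `b`.
  obtain ⟨S, hS⟩ : ∃ S : Set ℝ, ∀ x, x ∈ S ↔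
      ∃ b, (c < b ∧ b ≤ u₀) ∧ x * (b - c) = X.weight b - X.weight c :=
    ⟨{x | ∃ b, (c < b ∧ b ≤ u₀) ∧ x * (b - c) = X.weight b - X.weight c}, fun _ => Iff.rfl⟩
  have hSmem : ∀ b, c < b → b ≤ u₀ → (X.weight b - X.weight c) / (b - c) ∈ S := by
    intro b hb1 hb2
    refine (hS _).2 ⟨b, ⟨hb1, hb2⟩, div_mul_cancel₀ _ (by linarith)⟩
  have hr0 : 0 < (X.weight c - X.weight a₀) / (c - a₀) := by
    obtain ⟨m, hm1, hm2⟩ := exists_between ha2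
    have h1 := X.le_weight_sub ha0 ha2.le (by linarith)
    have h2 : X m - X a₀ ≤ X.measure.real (Ico a₀ c) := by
      rw [← X.real_Ioc ha0 hm1.le (by linarith)]
      exact measureReal_mono (fun s hs => ⟨hs.1.le, hs.2.trans_lt hm2⟩)
        (X.measure_ne_top_of_subset (b := c) (by linarith) fun s hs => hs.2.le)
    have h3 := hX a₀ m ha1 hm1 (by linarith)
    have h4 : 0 < (1 - c) * X.measure.real (Ico a₀ c) := mul_pos hc1' (by linarith)
    exact div_pos (by linarith) (by linarith)
  have hSlow : ∀ x ∈ S, (X.weight c - X.weight a₀) / (c - a₀) ≤ x := by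
    intro x hx
    obtain ⟨b, ⟨hb1, hb2⟩, hb3⟩ := (hS x).1 hx
    have h1 := chordX a₀ c b ha0 ha2 hb1 (by linarith) hc1 hc2
    rw [← hb3] at h1
    rw [div_le_iff₀ (by linarith)]
    refine le_of_mul_le_mul_left ?_ (show 0 < b - c by linarith)
    linarith
  have hSb : BddBelow S := ⟨_, hSlow⟩
  have hSn : S.Nonempty := ⟨_, hSmem u₀ hu1 le_rfl⟩
  obtain ⟨l, hl⟩ : ∃ l, l = sInf S := ⟨_, rfl⟩
  have hl0 : 0 < l := hl ▸ hr0.trans_le (le_csInf hSn hSlow)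
  obtain ⟨y, hyS, hy⟩ := exists_lt_of_csInf_lt hSn (show sInf S < 2 * l by linarith)
  obtain ⟨b, ⟨hb1, hb2⟩, hb3⟩ := (hS y).1 hyS
  have hXup : X.weight b - X.weight c ≤ 2 * l * (b - c) := by
    rw [← hb3]
    exact mul_le_mul_of_nonneg_right hy.le (by linarith)
  have hXlow : ∀ v, c < v → v ≤ u₀ → l * (v - c) ≤ X.weight v - X.weight c := by
    intro v hv1 hv2
    have := csInf_le hSb (hSmem v hv1 hv2)
    rw [← hl] at this
    rwa [le_div_iff₀ (by linarith)] at this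
  have hbone : b < 1 := by linarith
  obtain ⟨m, hm⟩ : ∃ m, m = (c + b) / 2 := ⟨_, rfl⟩
  have hcm : c < m := by linarith
  have hmb : m < b := by linarith
  have hpool := hsol.pool_both_le hc0 hb1 hbone
  have hB0 := X.upperShift_nonneg hc0 hb1 hbone
  have hA0 : 0 ≤ X.avg c b - X c := sub_nonneg.2 (X.le_avg hc0 hb1 hbone.le)
  have hBle : X.upperShift c b ≤ X.measure.real (Ico c b) := by
    have : X.measure.real (Ioo c b) ≤ X.measure.real (Ico c b) :=
      measureReal_mono Ioo_subset_Ico_self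
        (X.measure_ne_top_of_subset hbone fun s hs => hs.2.le)
    rw [upperShift]
    linarith
  have i3 : IntegrableOn (fun t => (1 - t) * W t) (Ioo c b) X.measure :=
    (W.integrableOn_mul hc0 hb1.le hbone (X.measure_Icc_ne_top hbone)).mono_set
      Ioo_subset_Icc_self
  have i4 : IntegrableOn (fun t => 1 - t) (Ioo c b) X.measure :=
    X.integrableOn_Ioo hbone (by fun_prop)
  have i5 : IntegrableOn (fun t => t - c) (Ioo c b) X.measure :=
    X.integrableOn_Ioo hbone (by fun_prop)
  have hint : ∫ t in Ioo c b, (1 - t) * W t ∂X.measure ≤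
      ((1 - c) * (X.avg c b - X c) + (1 - b) * X.upperShift c b) * W c +
        (b - c) * X.upperShift c b * k := by
    rw [← X.integral_one_sub hc0 hb1 hbone, X.upperShift_mul hc0 hb1 hbone, ← integral_mul_const,
      ← integral_mul_const, ← integral_add (i4.mul_const _) (i5.mul_const _)]
    refine setIntegral_mono_on i3 ((i4.mul_const _).add (i5.mul_const _)) measurableSet_Ioo
      fun t ht => ?_
    have := hWup t ht.1 (by linarith [ht.2])
    linarith
  have hmass : X.measure.real (Ico c m) ≤ 2 * (X.measure.real {c} + (X.avg c b - X c)) := by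
    have h1 := X.real_Icc hc0 hcm.le (hmb.trans hbone)
    have h2 : X.measure.real (Ico c m) ≤ X.measure.real (Icc c m) :=
      measureReal_mono Ico_subset_Icc_self (X.measure_Icc_ne_top (hmb.trans hbone))
    have h3 := X.le_avg_of_mem hc0 hcm.le hmb hbone.le
    have h4 : X m - X c ≤ 2 * (X.avg c b - X c) := by
      refine le_of_mul_le_mul_left ?_ (show 0 < b - m by linarith)
      have : b - c = 2 * (b - m) := by linarith
      rw [this] at h3
      linarith
    have h5 : 0 ≤ X.measure.real {c} := measureReal_nonneg
    linarith
  have hWavg : 127 / 512 * k * (b - c) ≤ (1 - c) * (W.avg c b - W c) := by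
    have h1 := hWlow m hcm (by linarith)
    have h3 := W.le_avg_of_mem hc0 hcm.le hmb hbone.le
    have h4 : W m - W c ≤ 2 * (W.avg c b - W c) := by
      refine le_of_mul_le_mul_left ?_ (show 0 < b - m by linarith)
      have : b - c = 2 * (b - m) := by linarith
      rw [this] at h3
      linarith
    have h5 := hW c m hc1 hcm (by linarith)
    have h6 : (1 - m) * (W m - W c) ≤ (1 - c) * (W m - W c) :=
      mul_le_mul_of_nonneg_right (by linarith) (by linarith)
    have h7 := mul_le_mul_of_nonneg_left h4 hc1'.le
    have h8 : m - c = (b - c) / 2 := by linarith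
    rw [h8] at h1
    linarith
  obtain ⟨A, hA⟩ : ∃ A, A = X.measure.real {c} + (X.avg c b - X c) := ⟨_, rfl⟩
  obtain ⟨B, hB⟩ : ∃ B, B = X.upperShift c b := ⟨_, rfl⟩
  have hAnn : 0 ≤ A := hA ▸ add_nonneg measureReal_nonneg hA0
  have e1 : (1 - c) * (W.avg c b - W c) * A + (1 - b) * (W b - W c) * B ≤ k * (b - c) * B := by
    rw [hA, hB]
    linarith
  have e2 : 127 / 512 * k * (b - c) * A ≤ (1 - c) * (W.avg c b - W c) * A :=
    mul_le_mul_of_nonneg_right hWavg hAnn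
  have e3 : 127 / 128 * k * (b - c) * B ≤ (1 - b) * (W b - W c) * B :=
    mul_le_mul_of_nonneg_right (hWlow b hb1 hb2) (hB ▸ hB0)
  have e4 : 127 * A ≤ 4 * B := by
    refine le_of_mul_le_mul_left ?_ (mul_pos hk0 (show 0 < b - c by linarith))
    linarith
  have e5 := X.weight_sub_le hc0 hcm.le (hmb.trans hbone)
  have e6 := hXlow m hcm (by linarith)
  have e7 := X.le_weight_sub hc0 hb1.le hbone
  have e8 : (1 - c) * X.measure.real (Ico c m) ≤ (1 - c) * (2 * A) :=
    mul_le_mul_of_nonneg_left (hA ▸ hmass) hc1'.le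
  have e9 : (1 - b) * B ≤ (1 - b) * X.measure.real (Ico c b) :=
    mul_le_mul_of_nonneg_left (hB ▸ hBle) (by linarith)
  have e10 : (1 - c) * B ≤ 2 * ((1 - b) * B) := by
    have : (1 - c) * B ≤ (2 * (1 - b)) * B :=
      mul_le_mul_of_nonneg_right (by linarith) (hB ▸ hB0)
    linarith
  have e11 := mul_le_mul_of_nonneg_left e4 hc1'.le
  have e12 : m - c = (b - c) / 2 := by linarith
  rw [e12] at e6
  have e13 : 0 < l * (b - c) := mul_pos hl0 (by linarith)
  linarith

/-- A served quantile below the top pool begins an interval on which both the expected value and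
the quality are constant. -/
theorem exists_const_right (hsol : IsSolution V Q W X) {t₀ b : ℝ} (h0 : 0 ≤ t₀) (htb : t₀ < b)
    (hb : b < 1) (hWb : W t₀ < W b) (hpos : ∀ s, t₀ < s → s < 1 → 0 < X s) :
    ∃ d, t₀ < d ∧ d ≤ 1 ∧ (∀ s ∈ Ico t₀ d, W s = W t₀) ∧ ∀ s ∈ Ico t₀ d, X s = X t₀ := by
  have ht1 : t₀ < 1 := htb.trans hb
  by_contra! hcon
  have hWlt : ∀ s, t₀ < s → s < 1 → W t₀ < W s := by
    intro s hs1 hs2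
    refine lt_of_le_of_ne (W.mono h0 hs1.le hs2) fun h => ?_
    have hc : ∀ r ∈ Ico t₀ s, W r = W t₀ := fun r hr =>
      le_antisymm (h ▸ W.mono (h0.trans hr.1) hr.2.le hs2) (W.mono h0 hr.1 (hr.2.trans hs2))
    obtain ⟨r, hr, hne⟩ := hcon s hs1 hs2.le hc
    exact hne (hsol.qualities_const h0 hb hc hWb htb r hr)
  have hXlt : ∀ s, t₀ < s → s < 1 → X t₀ < X s := by
    intro s hs1 hs2
    refine lt_of_le_of_ne (X.mono h0 hs1.le hs2) fun h => ?_
    have hc : ∀ r ∈ Ico t₀ s, X r = X t₀ := fun r hr =>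
      le_antisymm (h ▸ X.mono (h0.trans hr.1) hr.2.le hs2) (X.mono h0 hr.1 (hr.2.trans hs2))
    obtain ⟨r, hr, hne⟩ := hcon s hs1 hs2.le (hsol.values_const h0 hs2.le hc (h ▸ hpos s hs1 hs2))
    exact hne (hc r hr)
  obtain ⟨t₁, ht₁, ht₁1, hWt₁⟩ := W.exists_forall_lt h0 ht1 hWb
  have ht₁b : t₁ ≤ b := by
    by_contra! h
    exact lt_irrefl _ (hWt₁ b ⟨htb.le, h⟩)
  -- Pooling intervals accumulate at `t₀` from the right.
  have hacc : ∀ u, t₀ < u → u ≤ t₁ → ∃ p q s, t₀ < p ∧ p ≤ s ∧ s < u ∧ s < q ∧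
      IsPoolingInterval W X p q := by
    intro u hu1 hu2
    have hu : u < 1 := hu2.trans_lt ht₁1
    have key : ∃ r s, t₀ < r ∧ r < s ∧ s < u ∧ W s = W r := by
      by_contra! hne
      refine hsol.not_strictMono h0 hu1 hu (fun x y h1 h2 h3 =>
        lt_of_le_of_ne (W.mono (h0.trans h1.le) h2.le (h3.trans hu)) fun h =>
          hne x y h1 h2 h3 h.symm)
        fun x y h1 h2 h3 => lt_of_le_of_ne (X.mono (h0.trans h1.le) h2.le (h3.trans hu)) fun h => ?_
      obtain ⟨z, hz1, hz2⟩ := exists_between h2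
      refine hne x z h1 hz1 (hz2.trans h3) ?_
      refine hsol.values_const (h0.trans h1.le) (h3.trans hu).le (fun r hr => ?_)
        (hpos x h1 ((h2.trans h3).trans hu)) z ⟨hz1.le, hz2⟩
      exact le_antisymm (h ▸ X.mono ((h0.trans h1.le).trans hr.1) hr.2.le (h3.trans hu))
        (X.mono (h0.trans h1.le) hr.1 (hr.2.trans (h3.trans hu)))
    obtain ⟨r, s, hr1, hrs, hsu, hWrs⟩ := key
    have hr1' : r < 1 := by linarith
    obtain ⟨p, q, hp1, hp2, hp3, -, hg⟩ := hsol.exists_isPoolingInterval (h0.trans hr1.le) hrs hb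
      (by linarith) (hpos r hr1 hr1') (hWt₁ r ⟨hr1.le, by linarith⟩) fun v hv =>
        le_antisymm (hWrs ▸ W.mono ((h0.trans hr1.le).trans hv.1) hv.2.le (by linarith))
          (W.mono (h0.trans hr1.le) hv.1 (by linarith [hv.2]))
    refine ⟨p, q, r, ?_, hp2, by linarith, hp3, hg⟩
    by_contra! hpt
    have h1 := X.mono hg.nonneg hpt ht1
    have h2 := hXlt r hr1 hr1'
    rw [hp1] at h1
    linarith
  obtain ⟨p₁, q₁, s₁, hp₁, hps₁, hsu₁, -, hg₁⟩ := hacc t₁ ht₁ le_rfl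
  have hη : 0 < (1 - q₁) * (W q₁ - W p₁) :=
    mul_pos (by linarith [hg₁.lt_one]) (sub_pos.2 hg₁.jump)
  obtain ⟨u, hu1, -, hu2⟩ := W.exists_forall_lt h0 ht1
    (show W t₀ < W t₀ + (1 - q₁) * (W q₁ - W p₁) by linarith)
  have hmin : t₀ < min u p₁ := lt_min hu1 hp₁
  have hp₁t₁ : p₁ < t₁ := hps₁.trans_lt hsu₁
  obtain ⟨p₂, q₂, s₂, hp₂, hps₂, hsu₂, -, hg₂⟩ :=
    hacc (min u p₁) hmin ((min_le_right _ _).trans hp₁t₁.le)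
  have hp₂' : p₂ < min u p₁ := hps₂.trans_lt hsu₂
  obtain ⟨p₃, q₃, s₃, hp₃, hps₃, hsu₃, -, hg₃⟩ :=
    hacc p₂ hp₂ ((hp₂'.trans_le (min_le_right _ _)).le.trans hp₁t₁.le)
  have hp₃p₂ : p₃ < p₂ := hps₃.trans_lt hsu₃
  have hq₃ : q₃ ≤ p₂ := (hg₃.eq_or_le hg₂ hp₃p₂.le).resolve_left fun h => hp₃p₂.ne h.1
  have hq₃u : q₃ < u := hq₃.trans_lt (hp₂'.trans_le (min_le_left _ _))
  have hq₃p : q₃ ≤ p₁ := hq₃.trans (hp₂'.trans_le (min_le_right _ _)).le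
  obtain ⟨n, hn⟩ := exists_nat_gt ((X p₁ - X p₃) / X.measure.real {p₃})
  rw [div_lt_iff₀ hg₃.atom] at hn
  have hjump := hsol.jump_le_jump hg₁ n p₃ q₃ hg₃ hq₃p le_rfl hn
  have h1 := hu2 q₃ ⟨(hp₃.trans hg₃.lt).le, hq₃u⟩
  have h2 := W.mono h0 hp₃.le (hg₃.lt.trans hg₃.lt_one)
  have h3 : (1 - q₃) * (W q₃ - W p₃) ≤ W q₃ - W p₃ :=
    mul_le_of_le_one_left (sub_nonneg.2 hg₃.jump.le) (by linarith [hg₃.nonneg, hg₃.lt])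
  linarith

end IsSolution

/-! ### From local to maximal constancy -/

/-- If each point of `[l, u)` begins an interval on which `F` and `G` are constant, the maximal
such intervals partition `[l, u)`. -/
theorem exists_isIntervalFamily {F G : QuantileFunction} {l u : ℝ} (hl : 0 ≤ l) (hu : u ≤ 1)
    (h : ∀ t ∈ Ico l u, ∃ d, t < d ∧ (∀ s ∈ Ico t d, F s = F t) ∧ ∀ s ∈ Ico t d, G s = G t) :
    ∃ I : Set (ℝ × ℝ), IsIntervalFamily I ∧ coveredSet I = Ico l u ∧
      ∀ J ∈ I, PooledOn F (Ico J.1 J.2) ∧ PooledOn G (Ico J.1 J.2) := by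
  obtain ⟨C, hC⟩ : ∃ C : ℝ → Set ℝ, ∀ c s, s ∈ C c ↔ s ∈ Ico l u ∧ F s = F c ∧ G s = G c :=
    ⟨fun c => {s | s ∈ Ico l u ∧ F s = F c ∧ G s = G c}, fun _ _ => Iff.rfl⟩
  have hself : ∀ c ∈ Ico l u, c ∈ C c := fun c hc => (hC c c).2 ⟨hc, rfl, rfl⟩
  have hCeq : ∀ c s, s ∈ C c → C s = C c := by
    intro c s hs
    obtain ⟨-, h1, h2⟩ := (hC c s).1 hs
    ext r
    rw [hC, hC, h1, h2]
  have hIco : ∀ c ∈ Ico l u, C c = Ico (sInf (C c)) (sSup (C c)) ∧ l ≤ sInf (C c) ∧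
      sInf (C c) < sSup (C c) ∧ sSup (C c) ≤ u := by
    intro c hc
    have hne : (C c).Nonempty := ⟨c, hself c hc⟩
    have hb : BddBelow (C c) := ⟨l, fun s hs => ((hC c s).1 hs).1.1⟩
    have hB : BddAbove (C c) := ⟨u, fun s hs => ((hC c s).1 hs).1.2.le⟩
    have hla : l ≤ sInf (C c) := le_csInf hne fun s hs => ((hC c s).1 hs).1.1
    have hau : sInf (C c) < u := (csInf_le hb (hself c hc)).trans_lt hc.2
    have hbu : sSup (C c) ≤ u := csSup_le hne fun s hs => ((hC c s).1 hs).1.2.le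
    have ha : sInf (C c) ∈ C c := by
      obtain ⟨d, hd, hF, hG⟩ := h _ ⟨hla, hau⟩
      obtain ⟨s, hs, hsd⟩ := exists_lt_of_csInf_lt hne hd
      have hs' : s ∈ Ico (sInf (C c)) d := ⟨csInf_le hb hs, hsd⟩
      obtain ⟨-, h1, h2⟩ := (hC c s).1 hs
      exact (hC c _).2 ⟨⟨hla, hau⟩, by rw [← hF s hs', h1], by rw [← hG s hs', h2]⟩
    have hbn : sSup (C c) ∉ C c := by
      intro hbc
      obtain ⟨h0, h1, h2⟩ := (hC c _).1 hbc
      obtain ⟨d, hd, hF, hG⟩ := h _ h0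
      obtain ⟨s, hs1, hs2⟩ := exists_between (lt_min hd h0.2)
      have hs' : s ∈ Ico (sSup (C c)) d := ⟨hs1.le, hs2.trans_le (min_le_left _ _)⟩
      have : s ∈ C c := (hC c s).2 ⟨⟨h0.1.trans hs1.le, hs2.trans_le (min_le_right _ _)⟩,
        by rw [hF s hs', h1], by rw [hG s hs', h2]⟩
      exact not_lt.2 (le_csSup hB this) hs1
    have hlt : ∀ s ∈ C c, s < sSup (C c) := fun s hs =>
      lt_of_le_of_ne (le_csSup hB hs) fun e => hbn (e ▸ hs)
    refine ⟨Subset.antisymm (fun s hs => ⟨csInf_le hb hs, hlt s hs⟩) fun s hs => ?_, hla,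
      hlt _ ha, hbu⟩
    obtain ⟨r, hr, hsr⟩ := exists_lt_of_lt_csSup hne hs.2
    obtain ⟨hr0, hr1, hr2⟩ := (hC c r).1 hr
    obtain ⟨-, ha1, ha2⟩ := (hC c _).1 ha
    have hs0 : 0 ≤ s := hl.trans (hla.trans hs.1)
    have hr1' : r < 1 := hr0.2.trans_le hu
    refine (hC c s).2 ⟨⟨hla.trans hs.1, hsr.trans hr0.2⟩, le_antisymm ?_ ?_, le_antisymm ?_ ?_⟩
    · exact hr1 ▸ F.mono hs0 hsr.le hr1'
    · exact ha1 ▸ F.mono (hl.trans hla) hs.1 (hsr.trans hr1')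
    · exact hr2 ▸ G.mono hs0 hsr.le hr1'
    · exact ha2 ▸ G.mono (hl.trans hla) hs.1 (hsr.trans hr1')
  -- Every class contains a rational number, so there are only countably many.
  refine ⟨(fun r : ℚ => (sInf (C r), sSup (C r))) '' {r : ℚ | (r : ℝ) ∈ Ico l u},
    ⟨(Set.to_countable _).image _, ?_, ?_⟩, ?_, ?_⟩
  · rintro _ ⟨r, hr, rfl⟩
    obtain ⟨-, h1, h2, h3⟩ := hIco r hr
    exact ⟨hl.trans h1, h2, h3.trans hu⟩
  · rintro _ ⟨r, hr, rfl⟩ _ ⟨r', hr', rfl⟩ hne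
    refine Set.disjoint_left.2 fun s hs hs' => hne ?_
    simp only at hs hs'
    rw [← (hIco r hr).1] at hs
    rw [← (hIco r' hr').1] at hs'
    simp only
    rw [← hCeq _ _ hs, ← hCeq _ _ hs']
  · ext t
    simp only [coveredSet, mem_iUnion, exists_prop]
    constructor
    · rintro ⟨_, ⟨r, hr, rfl⟩, ht⟩
      simp only at ht
      rw [← (hIco r hr).1] at ht
      exact ((hC _ _).1 ht).1
    · intro ht
      obtain ⟨d, hd, hF, hG⟩ := h t ht
      obtain ⟨r, hr1, hr2⟩ := exists_rat_btwn (lt_min hd ht.2)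
      have hr' : (r : ℝ) ∈ Ico t d := ⟨hr1.le, hr2.trans_le (min_le_left _ _)⟩
      have hr : (r : ℝ) ∈ Ico l u := ⟨ht.1.trans hr1.le, hr2.trans_le (min_le_right _ _)⟩
      refine ⟨_, ⟨r, hr, rfl⟩, ?_⟩
      simp only
      rw [← (hIco r hr).1]
      exact (hC _ _).2 ⟨ht, (hF r hr').symm, (hG r hr').symm⟩
  · rintro _ ⟨r, hr, rfl⟩
    simp only
    rw [← (hIco r hr).1]
    exact ⟨⟨F r, fun t ht => ((hC _ _).1 ht).2.1⟩, ⟨G r, fun t ht => ((hC _ _).1 ht).2.2⟩⟩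

/-- To the right of a quantile `t` with full disclosure, a monotone partitional function exceeds
its value at `t`. -/
theorem IsMonotonePartitional.lt_of_notMem {F G : QuantileFunction} {I : Set (ℝ × ℝ)}
    (h : IsMonotonePartitional F G I) (hI : IsIntervalFamily I) (hG : StrictMonoOn G (Ico 0 1))
    {t s : ℝ} (ht : 0 ≤ t) (hts : t < s) (hs : s < 1) (htI : t ∉ coveredSet I) : G t < F s := by
  have ht' : t ∈ Ico (0 : ℝ) 1 := ⟨ht, hts.trans hs⟩
  have hs' : s ∈ Ico (0 : ℝ) 1 := ⟨ht.trans hts.le, hs⟩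
  by_cases hsI : s ∈ coveredSet I
  · simp only [coveredSet, mem_iUnion, exists_prop] at hsI
    obtain ⟨J, hJ, hsJ⟩ := hsI
    obtain ⟨h0, h1, h2⟩ := hI.bounds J hJ
    have htJ : t < J.1 := by
      by_contra! h'
      refine htI ?_
      simp only [coveredSet, mem_iUnion, exists_prop]
      exact ⟨J, hJ, h', hts.trans hsJ.2⟩
    rw [h.1 J hJ s hsJ]
    exact (hG ht' ⟨h0, h1.trans_le h2⟩ htJ).trans_le (G.le_avg h0 h1 h2)
  · rw [h.2 s hs' hsI]
    exact hG ht' hs' hts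

theorem mainTheorem3 (V Q W X : QuantileFunction) (hsol : IsSolution V Q W X) :
    -- the solution consists of pooling intervals only
    (∃ tm th : ℝ, 0 ≤ tm ∧ tm ≤ th ∧ th ≤ 1 ∧
      (∀ t ∈ Ico 0 tm, X t = 0) ∧
      PooledOn W (Ico th 1) ∧
      ∃ I : Set (ℝ × ℝ), IsIntervalFamily I ∧ coveredSet I = Ico tm th ∧
        ∀ J ∈ I, PooledOn W (Ico J.1 J.2) ∧ PooledOn X (Ico J.1 J.2)) ∧
    -- a monotone partitional solution with common support is monotone pooling
    (∀ (I : Set (ℝ × ℝ)) (tm : ℝ), StrictMonoOn V (Ico 0 1) → StrictMonoOn Q (Ico 0 1) →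
      IsIntervalFamily I → 0 ≤ tm → tm ≤ 1 →
      IsMonotonePartitional W V I → IsWeakMonotonePartitional X Q I tm →
      Ico tm 1 ⊆ coveredSet I) ∧
    -- no interval has full disclosure combined with full separation
    (∀ t₁ t₂ : ℝ, 0 ≤ t₁ → t₁ < t₂ → t₂ ≤ 1 →
      StrictMonoOn V (Ico t₁ t₂) → StrictMonoOn Q (Ico t₁ t₂) →
      ¬ ((∀ t ∈ Ico t₁ t₂, W t = V t) ∧ ∀ t ∈ Ico t₁ t₂, X t = Q t)) := by
  refine ⟨?_, ?_, ?_⟩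
  · obtain ⟨A, hA⟩ : ∃ A : Set ℝ, ∀ t, t ∈ A ↔ t ∈ Icc (0 : ℝ) 1 ∧ (t < 1 → 0 < X t) :=
      ⟨{t | t ∈ Icc (0 : ℝ) 1 ∧ (t < 1 → 0 < X t)}, fun _ => Iff.rfl⟩
    obtain ⟨B, hB⟩ : ∃ B : Set ℝ, ∀ t, t ∈ B ↔ t ∈ Icc (0 : ℝ) 1 ∧ ∀ s ∈ Ico t 1, W s = W t :=
      ⟨{t | t ∈ Icc (0 : ℝ) 1 ∧ ∀ s ∈ Ico t 1, W s = W t}, fun _ => Iff.rfl⟩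
    have hA1 : (1 : ℝ) ∈ A := (hA 1).2 ⟨⟨zero_le_one, le_rfl⟩, fun h => (lt_irrefl _ h).elim⟩
    have hB1 : (1 : ℝ) ∈ B := (hB 1).2 ⟨⟨zero_le_one, le_rfl⟩, fun s hs =>
      (not_lt.2 hs.1 hs.2).elim⟩
    have hAb : BddBelow A := ⟨0, fun t ht => ((hA t).1 ht).1.1⟩
    have hBb : BddBelow B := ⟨0, fun t ht => ((hB t).1 ht).1.1⟩
    have hA0 : 0 ≤ sInf A := le_csInf ⟨1, hA1⟩ fun t ht => ((hA t).1 ht).1.1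
    have hB0 : 0 ≤ sInf B := le_csInf ⟨1, hB1⟩ fun t ht => ((hB t).1 ht).1.1
    have hB1' : sInf B ≤ 1 := csInf_le hBb hB1
    have hXpos : ∀ s, sInf A < s → s < 1 → 0 < X s := by
      intro s hs1 hs2
      obtain ⟨t, ht, hts⟩ := exists_lt_of_csInf_lt ⟨1, hA1⟩ hs1
      obtain ⟨h1, h2⟩ := (hA t).1 ht
      exact (h2 (hts.trans hs2)).trans_le (X.mono h1.1 hts.le hs2)
    -- If the top pool starts below the exclusion threshold, both thresholds are set to its start.
    refine ⟨min (sInf A) (sInf B), sInf B, le_min hA0 hB0, min_le_right _ _, hB1',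
      fun t ht => ?_, ⟨W (sInf B), fun s hs => ?_⟩, ?_⟩
    · have htA : t < sInf A := ht.2.trans_le (min_le_left _ _)
      have ht1 : t < 1 := htA.trans_le (csInf_le hAb hA1)
      refine le_antisymm ?_ (X.nonneg t ⟨ht.1, ht1⟩)
      by_contra! h
      exact not_lt.2 (csInf_le hAb ((hA t).2 ⟨⟨ht.1, ht1.le⟩, fun _ => h⟩)) htA
    · refine le_antisymm ?_ (W.mono hB0 hs.1 hs.2)
      by_contra! h
      have hlt : sInf B < s := lt_of_le_of_ne hs.1 fun e => by
        rw [e] at h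
        exact lt_irrefl _ h
      obtain ⟨v, hv1, -, hv2⟩ := W.exists_forall_lt hB0 (hlt.trans hs.2) h
      obtain ⟨t, ht, htv⟩ := exists_lt_of_csInf_lt ⟨1, hB1⟩ (lt_min hv1 hlt)
      have h1 := hv2 t ⟨csInf_le hBb ht, htv.trans_le (min_le_left _ _)⟩
      rw [((hB t).1 ht).2 s ⟨(htv.trans_le (min_le_right _ _)).le, hs.2⟩] at h1
      exact lt_irrefl _ h1
    · refine exists_isIntervalFamily (le_min hA0 hB0) hB1' fun t ht => ?_
      have ht0 : 0 ≤ t := (le_min hA0 hB0).trans ht.1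
      have htA : sInf A ≤ t := by
        rcases min_le_iff.1 ht.1 with h | h
        · exact h
        · exact (not_lt.2 h ht.2).elim
      have htB : t ∉ B := fun h => not_lt.2 (csInf_le hBb h) ht.2
      obtain ⟨s, hs, hne⟩ : ∃ s ∈ Ico t 1, W s ≠ W t := by
        by_contra! h
        exact htB ((hB t).2 ⟨⟨ht0, ht.2.le.trans hB1'⟩, h⟩)
      have hts : t < s := lt_of_le_of_ne hs.1 fun e => hne (by rw [e])
      obtain ⟨d, hd1, -, hd2, hd3⟩ := hsol.exists_const_right ht0 hts hs.2
        (lt_of_le_of_ne (W.mono ht0 hs.1 hs.2) hne.symm) fun r hr => hXpos r (htA.trans_lt hr)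
      exact ⟨d, hd1, hd2, hd3⟩
  · intro I tm hV hQ hI htm _ hW hX t ht
    by_contra htI
    obtain ⟨H, hH, hXH⟩ := hX
    have ht0 : 0 ≤ t := htm.trans ht.1
    have hWlt : ∀ s, t < s → s < 1 → W t < W s := fun s h1 h2 => by
      rw [hW.2 t ⟨ht0, ht.2⟩ htI]
      exact hW.lt_of_notMem hI hV ht0 h1 h2 htI
    obtain ⟨b, hb1, hb2⟩ := exists_between ht.2
    obtain ⟨d, hd1, hd2, hd3, -⟩ := hsol.exists_const_right ht0 hb1 hb2 (hWlt b hb1 hb2)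
      fun s h1 h2 => by
        rw [hXH s ⟨ht0.trans h1.le, h2⟩, if_pos (ht.1.trans h1.le)]
        exact (Q.nonneg t ⟨ht0, ht.2⟩).trans_lt (hH.lt_of_notMem hI hQ ht0 h1 h2 htI)
    obtain ⟨s, hs1, hs2⟩ := exists_between hd1
    exact (hWlt s hs1 (hs2.trans_le hd2)).ne (hd3 s ⟨hs1.le, hs2⟩).symm
  · rintro t₁ t₂ h0 h12 h2 hV hQ ⟨hWV, hXQ⟩
    have ht₁ : t₁ ∈ Ico t₁ t₂ := ⟨le_rfl, h12⟩
    have hWlt : ∀ s ∈ Ioo t₁ t₂, W t₁ < W s := fun s hs => by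
      rw [hWV t₁ ht₁, hWV s (Ioo_subset_Ico_self hs)]
      exact hV ht₁ (Ioo_subset_Ico_self hs) hs.1
    obtain ⟨b, hb1, hb2⟩ := exists_between h12
    obtain ⟨d, hd1, -, hd3, -⟩ := hsol.exists_const_right h0 hb1 (hb2.trans_le h2)
      (hWlt b ⟨hb1, hb2⟩) fun s h1 h3 => by
        obtain ⟨r, hr1, hr2⟩ := exists_between (lt_min h1 h12)
        have hr : r ∈ Ico t₁ t₂ := ⟨hr1.le, hr2.trans_le (min_le_right _ _)⟩
        have hrs : r < s := hr2.trans_le (min_le_left _ _)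
        refine lt_of_lt_of_le ?_ (X.mono (h0.trans hr1.le) hrs.le h3)
        rw [hXQ r hr]
        exact (Q.nonneg t₁ ⟨h0, h12.trans_le h2⟩).trans_lt (hQ ht₁ hr hr1)
    obtain ⟨s, hs1, hs2⟩ := exists_between (lt_min hd1 h12)
    exact (hWlt s ⟨hs1, hs2.trans_le (min_le_right _ _)⟩).ne
      (hd3 s ⟨hs1.le, hs2.trans_le (min_le_left _ _)⟩).symm

end
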